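/- **Definitions.** Let $\Bbbk$ be a field and $A$ an associative unital $\Bbbk$-algebra. A *differential calculus* over $A$ is an $\mathbb N$-graded algebra $\Omega=\bigoplus_n\Omega^n$ (product $\wedge$) with $\Omega^0=A$, together with a $\Bbbk$-linear map $d:\Omega^\bullet\to\Omega^{\bullet+1}$ satisfying the graded Leibniz rule and $d\circ d=0$, such that $\Omega^n=A\,dA\wedge\dots\wedge dA$ ($n$ factors $dA$) for all $n$. It is *connected* if $\ker(d|_A)=\Bbbk$, and has *dimension* $n$ if $\Omega^n\neq0$ and $\Omega^m=0$ for $m>n$. A *volume form* of an $n$-dimensional calculus is an $\omega\in\Omega^n$ that is a free generator of $\Omega^n$ both as a right and as a left $A$-module. Let $\mathcal I_kA$ be the $A$-bimodule of right $A$-linear maps $\Omega^k\to A$, with $(a\cdot\phi\cdot b)(\eta)=a\,\phi(b\eta)$, and put $(\phi\cdot\eta)(\eta')=\phi(\eta\wedge\eta')$ for $\phi\in\mathcal I_{k+m}A$, $\eta\in\Omega^k$, $\eta'\in\Omega^m$. A *divergence* is a $\Bbbk$-linear map $\nabla:\mathcal I_1A\to A$ with $\nabla(\phi\cdot a)=\nabla(\phi)a+\phi(da)$;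 it extends to $\nabla_k:\mathcal I_{k+1}A\to\mathcal I_kA$ by $\nabla_k(\phi)(\eta)=\nabla(\phi\cdot\eta)+(-1)^{k+1}\phi(d\eta)$, where $\mathcal I_0A=\mathrm{Hom}_A(A,A)$ is identified with $A$ and $\nabla_0$ with $\nabla$; it is *flat* if $\nabla\circ\nabla_1=0$. An $n$-dimensional calculus is *integrable* if there are a flat divergence $\nabla$, an algebra automorphism $\sigma$ of $A$ and $A$-bimodule isomorphisms $\Theta_k:\Omega^k\to{}^{\sigma}\mathcal I_{n-k}A$ for $0\le k\le n$ (left action on the target twisted by $\sigma$) with $\Theta_{k+1}\circ d=\nabla_{n-k-1}\circ\Theta_k$ for $0\le k<n$; then $\Theta_n^{-1}(1)$ is called an *integrating volume form*. A finitely generated algebra $A$ whose Gelfand–Kirillov dimension is an integer $n$ is *differentially smooth* if it admits an $n$-dimensional connected integrable differential calculus. **Theorem.** Let $\Bbbk$ be a field of characteristic zero, let $q_1,q_2,q_3\in\Bbbk\setminus\{0\}$ and $a,b,c,\alpha,\beta,\gamma,\lambda,\mu,\nu,b_1,b_2,b_3\in\Bbbk$, and let $A$ be the $\Bbbk$-algebra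 generated by $x_1,x_2,x_3$ subject to the relations $$x_2x_1-q_1x_1x_2=ax_1+bx_2+cx_3+b_1,$$ $$x_3x_1-q_2x_1x_3=\alpha x_1+\beta x_2+\gamma x_3+b_2,$$ $$x_3x_2-q_3x_2x_3=\lambda x_1+\mu x_2+\nu x_3+b_3.$$ Assume that the monomials $x_1^ix_2^jx_3^k$ ($i,j,k\ge0$) form a $\Bbbk$-basis of $A$, and that $$c=\beta=\lambda=0,\quad b_1(q_1-1)=ab,\quad b_2(q_2-1)=\alpha\gamma,\quad b_3(q_3-1)=\mu\nu,\quad \mu a=0.$$ Then $A$ is differentially smooth and $\mathrm{GKdim}\,A=3$. More precisely, there are pairwise commuting algebra automorphisms $\nu_{x_1},\nu_{x_2},\nu_{x_3}$ of $A$ with $$\nu_{x_1}(x_1)=x_1,\quad \nu_{x_1}(x_2)=q_1x_2+a,\quad \nu_{x_1}(x_3)=q_2x_3+\alpha,$$ $$\nu_{x_2}(x_1)=q_1^{-1}x_1-bq_1^{-1},\quad \nu_{x_2}(x_2)=x_2,\quad \nu_{x_2}(x_3)=q_3x_3+\mu,$$ $$\nu_{x_3}(x_1)=q_2^{-1}x_1-\gamma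 q_2^{-1},\quad \nu_{x_3}(x_2)=q_3^{-1}x_2-\nu q_3^{-1},\quad \nu_{x_3}(x_3)=x_3,$$ and there is a connected integrable $3$-dimensional differential calculus $(\Omega,d)$ over $A$ such that $dx_1,dx_2,dx_3$ is a basis of the right $A$-module $\Omega^1$; $p\,dx_i=dx_i\,\nu_{x_i}(p)$ for all $p\in A$ and $i=1,2,3$; $dx_2\wedge dx_1=-q_1\,dx_1\wedge dx_2$, $dx_3\wedge dx_1=-q_2\,dx_1\wedge dx_3$, $dx_3\wedge dx_2=-q_3\,dx_2\wedge dx_3$; the forms $dx_1\wedge dx_2$, $dx_1\wedge dx_3$, $dx_2\wedge dx_3$ are a basis of the right $A$-module $\Omega^2$; and $dx_1\wedge dx_2\wedge dx_3$ is a volume form and an integrating volume form. -/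

import Mathlib

universe u v

/-! ### Gelfand–Kirillov dimension -/

/-- The Gelfand–Kirillov dimension of a `K`-algebra `A`: the supremum, over all finite-dimensional
subspaces `V` of `A`, of `limsup_n log (dim (K + V)^n) / log n`, where
`(K + V)^n = K + V + V^2 + ... + V^n`. -/
noncomputable def GKdim (K : Type u) (A : Type v) [Field K] [Ring A] [Algebra K A] : EReal :=
  ⨆ V : {V : Submodule K A // FiniteDimensional K V},
    Filter.limsup
      (fun n : ℕ => ((Real.log (Module.finrank K ↥((1 ⊔ V.1) ^ n)) / Real.log n : ℝ) : EReal))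
      Filter.atTop

/-! ### Differential graded algebras and differential calculi -/

/-- A differential graded algebra over `K`: an `ℕ`-graded associative unital `K`-algebra (whose
product is the wedge product) with a `K`-linear map `d` of degree one that satisfies the graded
Leibniz rule and `d ∘ d = 0`. -/
structure DGAlgebra (K : Type u) [Field K] where
  carrier : Type v
  [ring : Ring carrier]
  [algebra : Algebra K carrier]
  gr : ℕ → Submodule K carrier
  [graded : GradedAlgebra gr]
  d : carrier →ₗ[K] carrier
  d_mem : ∀ n : ℕ, ∀ ω ∈ gr n, d ω ∈ gr (n + 1)
  leibniz : ∀ n : ℕ, ∀ ω ∈ gr n, ∀ η : carrier,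
    d (ω * η) = d ω * η + (-1 : K) ^ n • (ω * d η)
  d_d : ∀ ω : carrier, d (d ω) = 0

attribute [instance] DGAlgebra.ring DGAlgebra.algebra DGAlgebra.graded

/-- A differential calculus over an algebra `A`: a differential graded algebra `Ω` together with an
identification `ι` of `A` with `Ω^0`, such that `Ω^n = A dA ∧ ... ∧ dA` (with `n` factors `dA`)
for all `n`; for `n = 0` this says that the image of `ι` is `Ω^0`. -/
structure DifferentialCalculus (K : Type u) [Field K] (A : Type v) [Ring A] [Algebra K A]
    extends DGAlgebra.{u, v} K where
  ι : A →ₐ[K] carrier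
  ι_injective : Function.Injective ι
  gr_eq : ∀ n : ℕ, gr n =
    LinearMap.range ι.toLinearMap * (LinearMap.range (d ∘ₗ ι.toLinearMap)) ^ n

namespace DifferentialCalculus

variable {K : Type u} [Field K] {A : Type v} [Ring A] [Algebra K A]

section Basic

variable (Ω : DifferentialCalculus K A)

/-- The form `da ∈ Ω^1`, for `a ∈ A`. -/
def dOf (a : A) : Ω.carrier := Ω.d (Ω.ι a)

/-- The calculus is connected: the kernel of `d` on `Ω^0 = A` is `K`. -/
def IsConnected : Prop :=
  ∀ a : A, Ω.dOf a = 0 ↔ ∃ r : K, a = algebraMap K A r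

/-- The calculus has dimension `n`. -/
def HasDimension (n : ℕ) : Prop :=
  Ω.gr n ≠ ⊥ ∧ ∀ m : ℕ, n < m → Ω.gr m = ⊥

/-- The form `ω ∈ Ω^n` is a free generator of `Ω^n`, both as a right and as a left `A`-module.
For an `n`-dimensional calculus this says that `ω` is a volume form. -/
def IsVolumeForm (n : ℕ) (ω : Ω.carrier) : Prop :=
  ω ∈ Ω.gr n ∧ (∀ η ∈ Ω.gr n, ∃! a : A, η = ω * Ω.ι a) ∧
    (∀ η ∈ Ω.gr n, ∃! a : A, η = Ω.ι a * ω)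

/-- The forms `e i ∈ Ω^n` are a basis of `Ω^n` as a right `A`-module. -/
def IsRightBasis {I : Type} [Fintype I] (n : ℕ) (e : I → Ω.carrier) : Prop :=
  (∀ i, e i ∈ Ω.gr n) ∧ ∀ η ∈ Ω.gr n, ∃! f : I → A, η = ∑ i, e i * Ω.ι (f i)

theorem ι_mem (a : A) : Ω.ι a ∈ Ω.gr 0 := by
  rw [Ω.gr_eq 0, pow_zero, mul_one]
  exact ⟨a, rfl⟩

theorem mul_ι_mem {n : ℕ} {ω : Ω.carrier} (hω : ω ∈ Ω.gr n) (a : A) : ω * Ω.ι a ∈ Ω.gr n := by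
  simpa using SetLike.mul_mem_graded hω (Ω.ι_mem a)

theorem ι_mul_mem {n : ℕ} {ω : Ω.carrier} (hω : ω ∈ Ω.gr n) (a : A) : Ω.ι a * ω ∈ Ω.gr n := by
  simpa using SetLike.mul_mem_graded (Ω.ι_mem a) hω

theorem dOf_mem (a : A) : Ω.dOf a ∈ Ω.gr 1 := Ω.d_mem 0 _ (Ω.ι_mem a)

/-- The unit `1 ∈ A = Ω^0`. -/
def one₀ : Ω.gr 0 := ⟨1, SetLike.GradedOne.one_mem⟩

/-- The right action `ω ↦ ω a` of `a ∈ A` on `Ω^n`. -/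
def rmul (n : ℕ) (a : A) : Ω.gr n →ₗ[K] Ω.gr n :=
  (LinearMap.mulRight K (Ω.ι a)).restrict fun _ hω => Ω.mul_ι_mem hω a

/-- The left action `ω ↦ a ω` of `a ∈ A` on `Ω^n`. -/
def lmul (n : ℕ) (a : A) : Ω.gr n →ₗ[K] Ω.gr n :=
  (LinearMap.mulLeft K (Ω.ι a)).restrict fun _ hω => Ω.ι_mul_mem hω a

/-- The map `η ↦ ω ∧ η` from `Ω^n` to `Ω^(m+n)`, for `ω ∈ Ω^m`. -/
def wedge {m : ℕ} (ω : Ω.gr m) (n : ℕ) : Ω.gr n →ₗ[K] Ω.gr (m + n) :=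
  (LinearMap.mulLeft K (ω : Ω.carrier)).restrict fun _ hη => SetLike.mul_mem_graded ω.2 hη

/-- The differential `d : Ω^n → Ω^(n+1)`. -/
def dGr (n : ℕ) : Ω.gr n →ₗ[K] Ω.gr (n + 1) :=
  Ω.d.restrict (Ω.d_mem n)

/-- The `1`-form `da` as an element of `Ω^1`. -/
def dOf₁ (a : A) : Ω.gr 1 := ⟨Ω.dOf a, Ω.dOf_mem a⟩

@[simp] theorem coe_rmul (n : ℕ) (a : A) (ω : Ω.gr n) :
    (Ω.rmul n a ω : Ω.carrier) = ω * Ω.ι a := rfl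

@[simp] theorem coe_lmul (n : ℕ) (a : A) (ω : Ω.gr n) :
    (Ω.lmul n a ω : Ω.carrier) = Ω.ι a * ω := rfl

@[simp] theorem coe_wedge {m : ℕ} (ω : Ω.gr m) (n : ℕ) (η : Ω.gr n) :
    (Ω.wedge ω n η : Ω.carrier) = ω * η := rfl

@[simp] theorem coe_dGr (n : ℕ) (ω : Ω.gr n) : (Ω.dGr n ω : Ω.carrier) = Ω.d ω := rfl

/-! ### Integral forms -/

/-- The space `I_n A = Hom_A(Ω^n, A)` of right `A`-linear maps from `Ω^n` to `A`. -/
def IntegralForms (n : ℕ) : Submodule K (Ω.gr n →ₗ[K] A) where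
  carrier := {φ | ∀ (ω : Ω.gr n) (a : A), φ (Ω.rmul n a ω) = φ ω * a}
  add_mem' := by
    intro φ ψ hφ hψ ω a
    simp [hφ ω a, hψ ω a, add_mul]
  zero_mem' := by
    intro ω a
    simp
  smul_mem' := by
    intro r φ hφ ω a
    simp [hφ ω a]

end Basic

section Actions

variable {Ω : DifferentialCalculus K A}

/-- The left action of `A` on `I_n A`: `(a · φ)(ω) = a φ(ω)`. -/
def lact {n : ℕ} (a : A) (φ : Ω.IntegralForms n) : Ω.IntegralForms n :=
  ⟨LinearMap.mulLeft K a ∘ₗ φ.1, fun ω b => by simp [φ.2 ω b, mul_assoc]⟩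

/-- The right action of `A` on `I_n A`: `(φ · a)(ω) = φ(a ω)`. -/
def ract {n : ℕ} (φ : Ω.IntegralForms n) (a : A) : Ω.IntegralForms n :=
  ⟨φ.1 ∘ₗ Ω.lmul n a, fun ω b => by
    have h : Ω.lmul n a (Ω.rmul n b ω) = Ω.rmul n b (Ω.lmul n a ω) := by
      apply Subtype.ext
      simp [mul_assoc]
    rw [LinearMap.comp_apply, LinearMap.comp_apply, h, φ.2]⟩

/-- The right action of forms on integral forms: for `φ ∈ I_(n+m) A` and `ω ∈ Ω^n`, the integral
form `φ · ω ∈ I_m A` is `(φ · ω)(ω') = φ(ω ∧ ω')`. -/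
def act {n m : ℕ} (φ : Ω.IntegralForms (n + m)) (ω : Ω.gr n) : Ω.IntegralForms m :=
  ⟨φ.1 ∘ₗ Ω.wedge ω m, fun η b => by
    have h : Ω.wedge ω m (Ω.rmul m b η) = Ω.rmul (n + m) b (Ω.wedge ω m η) := by
      apply Subtype.ext
      simp [mul_assoc]
    rw [LinearMap.comp_apply, LinearMap.comp_apply, h, φ.2]⟩

end Actions

/-- A divergence (hom-connection) on `A`: a `K`-linear map `∇ : I_1 A → A` such that
`∇(φ · a) = ∇(φ) a + φ(da)`. -/
structure Divergence (Ω : DifferentialCalculus K A) where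
  toFun : Ω.IntegralForms 1 →ₗ[K] A
  map_ract : ∀ (φ : Ω.IntegralForms 1) (a : A),
    toFun (ract φ a) = toFun φ * a + φ.1 (Ω.dOf₁ a)

namespace Divergence

variable {Ω : DifferentialCalculus K A}

/-- The extension `∇_n : I_(n+1) A → I_n A` of a divergence to higher integral forms,
`∇_n(φ)(ω) = ∇(φ · ω) + (-1)^(n+1) φ(dω)`. -/
def ext (D : Divergence Ω) (n : ℕ) (φ : Ω.IntegralForms (n + 1)) : Ω.IntegralForms n :=
  ⟨{ toFun := fun ω => D.toFun (act φ ω) + (-1 : K) ^ (n + 1) • φ.1 (Ω.dGr n ω)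
     map_add' := by
       intro ω η
       have h : act φ (ω + η) = act φ ω + act φ η := by
         apply Subtype.ext
         ext x
         simp only [act, Submodule.coe_add, LinearMap.add_apply,
           LinearMap.comp_apply, ← map_add]
         congr 1
         apply Subtype.ext
         simp [add_mul]
       rw [h, map_add, map_add, map_add, smul_add]
       abel
     map_smul' := by
       intro r ω
       have h : act φ (r • ω) = r • act φ ω := by
         apply Subtype.ext
         ext x
         simp only [act, Submodule.coe_smul, LinearMap.smul_apply,
           LinearMap.comp_apply, ← map_smul]
         congr 1
         apply Subtype.ext
         simp
       rw [h, map_smul, map_smul, map_smul, RingHom.id_apply, smul_add, smul_comm] },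
   fun ω a => by
     have h₁ : act φ (Ω.rmul n a ω) = ract (act φ ω) a := by
       apply Subtype.ext
       ext x
       simp only [act, ract, LinearMap.comp_apply]
       congr 1
       apply Subtype.ext
       simp [mul_assoc]
     have h₂ : Ω.dGr n (Ω.rmul n a ω) =
         Ω.rmul (n + 1) a (Ω.dGr n ω) + (-1 : K) ^ n • Ω.wedge ω 1 (Ω.dOf₁ a) := by
       apply Subtype.ext
       simpa [dOf₁, dOf] using Ω.leibniz n ω.1 ω.2 (Ω.ι a)
     have h₃ : (-1 : K) ^ (n + 1) * (-1) ^ n = -1 := by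
       rw [← pow_add, show n + 1 + n = 2 * n + 1 by ring]
       simp [pow_add, pow_mul]
     have h₄ : (act φ ω).1 (Ω.dOf₁ a) = φ.1 (Ω.wedge ω 1 (Ω.dOf₁ a)) := rfl
     simp only [LinearMap.coe_mk, AddHom.coe_mk]
     rw [h₁, D.map_ract, h₂, map_add, map_smul, φ.2, smul_add, smul_smul, h₃, h₄, add_mul,
       smul_mul_assoc, neg_one_smul]
     abel⟩

/-- The divergence is flat: its curvature `∇ ∘ ∇_1 : I_2 A → A` vanishes. Then `I A` with the maps
`∇_n` is a complex of integral forms. -/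
def IsFlat (D : Divergence Ω) : Prop :=
  ∀ φ : Ω.IntegralForms 2, D.toFun (D.ext 1 φ) = 0

end Divergence

/-- The data witnessing that an `n`-dimensional calculus is integrable: a complex of integral forms,
given by a flat divergence, an automorphism `σ` of `A`, and isomorphisms
`Θ_k : Ω^k → I_(n-k) A` of `A`-bimodules, where the left action of `A` on `I_(n-k) A` is twisted
by `σ`, which commute with the differentials `d` and `∇_j`. The map `Θ_k` is `Θ k m _` with
`k + m = n`, and `I_0 A = Hom_A(A, A)` is identified with `A` by `φ ↦ φ(1)`. -/
structure Integration (Ω : DifferentialCalculus K A) (n : ℕ) where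
  div : Divergence Ω
  flat : div.IsFlat
  σ : A ≃ₐ[K] A
  Θ : ∀ k m : ℕ, k + m = n → (Ω.gr k ≃ₗ[K] Ω.IntegralForms m)
  Θ_lmul : ∀ (k m : ℕ) (h : k + m = n) (a : A) (ω : Ω.gr k),
    Θ k m h (Ω.lmul k a ω) = lact (σ a) (Θ k m h ω)
  Θ_rmul : ∀ (k m : ℕ) (h : k + m = n) (a : A) (ω : Ω.gr k),
    Θ k m h (Ω.rmul k a ω) = ract (Θ k m h ω) a
  Θ_d : ∀ (k m : ℕ) (h : k + (m + 1) = n) (h' : (k + 1) + m = n) (ω : Ω.gr k),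
    Θ (k + 1) m h' (Ω.dGr k ω) = div.ext m (Θ k (m + 1) h ω)

/-- The (`n`-dimensional) calculus is integrable. -/
def IsIntegrable (Ω : DifferentialCalculus K A) (n : ℕ) : Prop :=
  Nonempty (Integration Ω n)

/-- The form `ω ∈ Ω^n` is an integrating volume form: `ω = Θ_n⁻¹(1)` for some choice of the data
that make the calculus integrable. -/
def IsIntegratingForm (Ω : DifferentialCalculus K A) (n : ℕ) (ω : Ω.carrier) : Prop :=
  ∃ (S : Integration Ω n) (hω : ω ∈ Ω.gr n), (S.Θ n 0 (add_zero n) ⟨ω, hω⟩).1 Ω.one₀ = 1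

end DifferentialCalculus

/-- An affine (finitely generated) `K`-algebra `A` is differentially smooth if its
Gelfand–Kirillov dimension is an integer `n` and it admits an `n`-dimensional connected integrable
differential calculus. -/
def IsDifferentiallySmooth (K : Type u) (A : Type v) [Field K] [Ring A] [Algebra K A] : Prop :=
  Algebra.FiniteType K A ∧ ∃ n : ℕ, GKdim K A = n ∧
    ∃ Ω : DifferentialCalculus K A, Ω.HasDimension n ∧ Ω.IsConnected ∧ Ω.IsIntegrable n

/-! ### Bi-quadratic algebras on three generators -/

/-- The structure constants of a bi-quadratic algebra on three generators: the nonzero scalars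
`q₁, q₂, q₃`, the rows `(a, b, c)`, `(α, β, γ)`, `(lam, μ, ν)` of the matrix of linear
coefficients, and the constant terms `b₁, b₂, b₃`. -/
structure BiquadraticData (K : Type u) [Field K] where
  (q₁ q₂ q₃ : K)
  (a b c : K)
  (α β γ : K)
  (lam μ ν : K)
  (b₁ b₂ b₃ : K)
  q₁_ne_zero : q₁ ≠ 0
  q₂_ne_zero : q₂ ≠ 0
  q₃_ne_zero : q₃ ≠ 0

namespace BiquadraticData

variable {K : Type u} [Field K] (D : BiquadraticData K)

/-- The defining relations
`x₂ x₁ - q₁ x₁ x₂ = a x₁ + b x₂ + c x₃ + b₁`,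
`x₃ x₁ - q₂ x₁ x₃ = α x₁ + β x₂ + γ x₃ + b₂`,
`x₃ x₂ - q₃ x₂ x₃ = lam x₁ + μ x₂ + ν x₃ + b₃`
on the free algebra, where `X 0, X 1, X 2` are the free generators corresponding to
`x₁, x₂, x₃`. -/
inductive Rel (X : Fin 3 → FreeAlgebra K (Fin 3)) :
    FreeAlgebra K (Fin 3) → FreeAlgebra K (Fin 3) → Prop
  | rel₁ : Rel X (X 1 * X 0 - D.q₁ • (X 0 * X 1))
      (D.a • X 0 + D.b • X 1 + D.c • X 2 + algebraMap K _ D.b₁)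
  | rel₂ : Rel X (X 2 * X 0 - D.q₂ • (X 0 * X 2))
      (D.α • X 0 + D.β • X 1 + D.γ • X 2 + algebraMap K _ D.b₂)
  | rel₃ : Rel X (X 2 * X 1 - D.q₃ • (X 1 * X 2))
      (D.lam • X 0 + D.μ • X 1 + D.ν • X 2 + algebraMap K _ D.b₃)

/-- The algebra generated by `x₁, x₂, x₃` subject to the defining relations. -/
abbrev Alg : Type u := RingQuot (D.Rel (FreeAlgebra.ι K))

/-- The generator `x₁`. -/
noncomputable def x₁ : D.Alg := RingQuot.mkAlgHom K _ (FreeAlgebra.ι K 0)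

/-- The generator `x₂`. -/
noncomputable def x₂ : D.Alg := RingQuot.mkAlgHom K _ (FreeAlgebra.ι K 1)

/-- The generator `x₃`. -/
noncomputable def x₃ : D.Alg := RingQuot.mkAlgHom K _ (FreeAlgebra.ι K 2)

/-- The monomials `x₁^i x₂^j x₃^k`. -/
noncomputable def monomial (e : ℕ × ℕ × ℕ) : D.Alg :=
  D.x₁ ^ e.1 * D.x₂ ^ e.2.1 * D.x₃ ^ e.2.2

/-- The algebra has PBW basis: the monomials `x₁^i x₂^j x₃^k` form a `K`-basis. -/
def HasPBWBasis : Prop :=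
  LinearIndependent K D.monomial ∧ Submodule.span K (Set.range D.monomial) = ⊤

end BiquadraticData

/-!
The calculus is built on a twisted exterior algebra. Given pairwise commuting automorphisms `ν i` of
`A` and scalars `θ i j`, the free right `A`-module on symbols `e S`, for `S` a finite set of indices,
is an associative algebra under `(e S) a (e T) b = coeff S T • e (S ∪ T) (ν_T a) b`, because `coeff`
satisfies the cocycle identity `SkewFrame.coeff_assoc` and `ν_{S ∪ T} = ν_S ν_T` for disjoint `S`,
`T`. If moreover `pd i` is a `ν i`-skew derivation with `pd i (x j) = δ i j` on generators `x j`,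
then `d ((e S) a) = (-1) ^ |S| ∑ i, (e S) (e i) (pd i a)` is a differential. The graded Leibniz rule
and `d ∘ d = 0` amount to commutation rules up to scalars between the `pd i` and the `ν j`, and among
the `pd i` (`SkewCalculus.ν_pd`, `SkewCalculus.pd_pd`). Both are statements about twisted derivations
of `A`, so they only have to be checked on the generators, where they fix `θ` in terms of the scaling
factors of the automorphisms (the field `s_mul_θ`).

Integrability is a form of Poincaré duality. With `π` the coefficient of the top form `e univ`, the
pairing `(ω, η) ↦ π (ω ∧ η)` of complementary degrees is perfect, since `(e S) (e Sᶜ)` is a nonzero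
multiple of `e univ` (`SkewCalculus.bijective_pairing`). It identifies `Ω^k` with the integral forms
of complementary degree, and transporting `π ∘ d` along it gives a divergence; the graded Leibniz
rule shows that the de Rham complex is carried to the complex of integral forms
(`DifferentialCalculus.ext_pairing`).

For the bi-quadratic algebra, comparing coefficients of normal monomials in
`x₃ (x₂ x₁) = (x₃ x₂) x₁` gives the scalar identities (`BiquadraticData.overlap`) under which the
prescribed substitutions preserve the defining relations and commute. The skew derivations come from
algebra maps to upper triangular matrices. They send `x₁^i x₂^j x₃^k` to `i x₁^(i-1) x₂^j x₃^k`, then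
`x₂^j x₃^k` to `j x₂^(j-1) x₃^k` and `x₃^k` to `k x₃^(k-1)`, so that in characteristic zero only
constants are killed by `d`. Finally the relations respect the filtration by total degree, whose
`N`-th term has at most `(N + 1) ^ 3` monomials, and conversely the monomials with exponents at most
`n / 3` have degree at most `n`; this gives Gelfand–Kirillov dimension three.
-/


/-! ### Twisted exterior algebras -/

/-- The data of a twisted exterior algebra over `A` on generators `e i`, `i : I`: pairwise commuting
automorphisms `ν i`, which give the commutation rule `a (e i) = (e i) (ν i a)`, and scalars
`θ i j`, nonzero for `i ≠ j`, for which `(e i) (e j) = θ i j • e {i, j}`. Thus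
`θ i j • (e j) (e i) = θ j i • (e i) (e j)`, and no order on `I` has to be chosen. The convention
`θ i i = 0` encodes `(e i) ^ 2 = 0`. -/
structure SkewFrame (K : Type u) (A : Type v) (I : Type) [Field K] [Ring A] [Algebra K A] where
  ν : I → A ≃ₐ[K] A
  ν_comm : ∀ i j, Commute (ν i) (ν j)
  θ : I → I → K
  θ_self : ∀ i, θ i i = 0
  θ_ne_zero : ∀ i j, i ≠ j → θ i j ≠ 0

namespace SkewFrame

variable {K : Type u} {A : Type v} {I : Type} [Field K] [Ring A] [Algebra K A]
variable (X : SkewFrame K A I)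

/-- The product of the automorphisms `ν i` over `i ∈ S`; it satisfies `a (e S) = (e S) (ν_S a)`. -/
noncomputable def aut (S : Finset I) : A ≃ₐ[K] A :=
  S.noncommProd X.ν fun i _ j _ _ => X.ν_comm i j

/-- The scalar in `(e S) (e T) = coeff S T • e (S ∪ T)`. It vanishes unless `S` and `T` are
disjoint. -/
def coeff (S T : Finset I) : K := ∏ i ∈ S, ∏ j ∈ T, X.θ i j

@[simp] theorem aut_empty : X.aut ∅ = 1 := Finset.noncommProd_empty _ _

@[simp] theorem aut_singleton (i : I) : X.aut {i} = X.ν i := Finset.noncommProd_singleton _ _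

@[simp] theorem coeff_empty_left (T : Finset I) : X.coeff ∅ T = 1 := rfl

@[simp] theorem coeff_empty_right (S : Finset I) : X.coeff S ∅ = 1 := by simp [coeff]

theorem coeff_singleton_left (i : I) (T : Finset I) : X.coeff {i} T = ∏ j ∈ T, X.θ i j := by
  simp [coeff]

theorem coeff_singleton_right (S : Finset I) (j : I) : X.coeff S {j} = ∏ i ∈ S, X.θ i j := by
  simp [coeff]

theorem coeff_eq_zero {S T : Finset I} (h : ¬Disjoint S T) : X.coeff S T = 0 := by
  obtain ⟨i, hS, hT⟩ := Finset.not_disjoint_iff.1 h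
  exact Finset.prod_eq_zero hS (Finset.prod_eq_zero hT (X.θ_self i))

theorem coeff_ne_zero {S T : Finset I} (h : Disjoint S T) : X.coeff S T ≠ 0 :=
  Finset.prod_ne_zero_iff.2 fun i hi => Finset.prod_ne_zero_iff.2 fun j hj =>
    X.θ_ne_zero i j (Finset.disjoint_iff_ne.1 h i hi j hj)

variable [DecidableEq I]

theorem aut_union {S T : Finset I} (h : Disjoint S T) : X.aut (S ∪ T) = X.aut S * X.aut T :=
  Finset.noncommProd_union_of_disjoint h _ _

theorem aut_insert {i : I} {S : Finset I} (h : i ∉ S) : X.aut (insert i S) = X.ν i * X.aut S :=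
  Finset.noncommProd_insert_of_notMem _ _ _ _ h

theorem aut_comm {S T : Finset I} (h : Disjoint S T) (a : A) :
    X.aut S (X.aut T a) = X.aut T (X.aut S a) := by
  have h' := (X.aut_union h).symm.trans
    ((congrArg X.aut (Finset.union_comm S T)).trans (X.aut_union h.symm))
  exact DFunLike.congr_fun h' a

theorem coeff_union_left {S T : Finset I} (h : Disjoint S T) (U : Finset I) :
    X.coeff (S ∪ T) U = X.coeff S U * X.coeff T U :=
  Finset.prod_union h

theorem coeff_union_right (S : Finset I) {T U : Finset I} (h : Disjoint T U) :
    X.coeff S (T ∪ U) = X.coeff S T * X.coeff S U := by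
  simp only [coeff, Finset.prod_union h, Finset.prod_mul_distrib]

/-- The cocycle identity of `coeff`, which makes the product of forms associative. -/
theorem coeff_assoc (S T U : Finset I) :
    X.coeff S T * X.coeff (S ∪ T) U = X.coeff T U * X.coeff S (T ∪ U) := by
  by_cases h₁ : Disjoint S T
  · by_cases h₂ : Disjoint T U
    · rw [X.coeff_union_left h₁, X.coeff_union_right S h₂]
      ring
    · rw [X.coeff_union_left h₁, X.coeff_eq_zero h₂]
      ring
  · by_cases h₂ : Disjoint T U
    · rw [X.coeff_union_right S h₂, X.coeff_eq_zero h₁]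
      ring
    · rw [X.coeff_eq_zero h₁, X.coeff_eq_zero h₂]
      ring

/-- The twisted exterior algebra of a skew frame. It is the free right `A`-module on the subsets of
`I`: the function `f` stands for the form `∑ S, (e S) (f S)`. -/
def Form (_ : SkewFrame K A I) : Type v := Finset I → A

namespace Form

variable {X}

noncomputable instance : AddCommGroup X.Form := inferInstanceAs (AddCommGroup (Finset I → A))

noncomputable instance : Module K X.Form := inferInstanceAs (Module K (Finset I → A))

/-- The coordinate `f S` of the form `f = ∑ S, (e S) (f S)`, as a linear map. -/
def coord (S : Finset I) : X.Form →ₗ[K] A := LinearMap.proj S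

/-- The form `(e S) a`. -/
def single (S : Finset I) : A →ₗ[K] X.Form := LinearMap.single K (fun _ => A) S

omit [DecidableEq I] in
theorem ext {f g : X.Form} (h : ∀ S, coord S f = coord S g) : f = g := funext h

theorem coord_single (S T : Finset I) (a : A) :
    coord T (single S a : X.Form) = if T = S then a else 0 := by
  by_cases h : T = S
  · subst h
    rw [if_pos rfl]
    exact Pi.single_eq_same (M := fun _ : Finset I => A) T a
  · rw [if_neg h]
    exact Pi.single_eq_of_ne (M := fun _ : Finset I => A) h a

@[simp] theorem coord_single_same (S : Finset I) (a : A) :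
    coord S (single S a : X.Form) = a := by simp [coord_single]

variable [Fintype I]

theorem sum_single (f : X.Form) : ∑ S, single S (coord S f) = f :=
  Finset.univ_sum_single (M := fun _ => A) f

@[elab_as_elim]
theorem induction {P : X.Form → Prop} (f : X.Form) (single : ∀ S a, P (single S a))
    (add : ∀ f g, P f → P g → P (f + g)) : P f := by
  rw [← sum_single f]
  exact Finset.sum_induction _ P add (by simpa using single ∅ 0) fun S _ => single S _

/-- The product of forms as a bilinear map. -/
noncomputable def mulHom : X.Form →ₗ[K] X.Form →ₗ[K] X.Form :=
  ∑ S, ∑ T, ((LinearMap.mul K A).compl₁₂ ((X.aut T).toLinearMap ∘ₗ coord S) (coord T)).compr₂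
    (X.coeff S T • single (S ∪ T))

noncomputable instance : Mul X.Form := ⟨fun f g => mulHom f g⟩

theorem mul_def (f g : X.Form) : f * g =
    ∑ S, ∑ T, X.coeff S T • single (S ∪ T) (X.aut T (coord S f) * coord T g) := by
  change mulHom f g = _
  simp [mulHom, LinearMap.sum_apply]

theorem single_mul_single (S T : Finset I) (a b : A) :
    (single S a * single T b : X.Form) = X.coeff S T • single (S ∪ T) (X.aut T a * b) := by
  rw [mul_def, Finset.sum_eq_single S, Finset.sum_eq_single T]
  · simp
  · intro U _ hU
    simp [coord_single, hU]
  · simp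
  · intro U _ hU
    simp [coord_single, hU]
  · simp

noncomputable instance : One X.Form := ⟨single ∅ 1⟩

omit [Fintype I] in
theorem one_def : (1 : X.Form) = single ∅ 1 := rfl

theorem form_add_mul (f g h : X.Form) : (f + g) * h = f * h + g * h :=
  LinearMap.map_add₂ mulHom f g h

theorem form_mul_add (f g h : X.Form) : f * (g + h) = f * g + f * h :=
  map_add (mulHom f) g h

theorem form_smul_mul (r : K) (f g : X.Form) : r • f * g = r • (f * g) :=
  LinearMap.map_smul₂ mulHom r f g

theorem form_mul_smul (r : K) (f g : X.Form) : f * r • g = r • (f * g) :=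
  map_smul (mulHom f) r g

theorem form_mul_assoc (f g h : X.Form) : f * g * h = f * (g * h) := by
  induction f using induction with
  | add f₁ f₂ h₁ h₂ => simp only [form_add_mul, h₁, h₂]
  | single S a =>
    induction g using induction with
    | add g₁ g₂ h₁ h₂ => simp only [form_add_mul, form_mul_add, h₁, h₂]
    | single T b =>
      induction h using induction with
      | add k₁ k₂ h₁ h₂ => simp only [form_mul_add, h₁, h₂]
      | single U k =>
        simp only [single_mul_single, form_smul_mul, form_mul_smul, smul_smul, X.coeff_assoc S T U,
          Finset.union_assoc]
        by_cases h : Disjoint T U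
        · rw [X.aut_union h, map_mul (X.aut U), AlgEquiv.mul_apply, X.aut_comm h, mul_assoc]
        · simp [X.coeff_eq_zero h]

noncomputable instance : Ring X.Form :=
  { (inferInstance : AddCommGroup X.Form) with
    mul := (· * ·)
    one := 1
    left_distrib := form_mul_add
    right_distrib := form_add_mul
    zero_mul := fun f => LinearMap.map_zero₂ mulHom f
    mul_zero := fun f => map_zero (mulHom f)
    mul_assoc := form_mul_assoc
    one_mul := fun f => by
      induction f using induction with
      | add f g hf hg => rw [form_mul_add, hf, hg]
      | single S a => simp [one_def, single_mul_single]
    mul_one := fun f => by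
      induction f using induction with
      | add f g hf hg => rw [form_add_mul, hf, hg]
      | single S a => simp [one_def, single_mul_single] }

noncomputable instance : Algebra K X.Form := Algebra.ofModule form_smul_mul form_mul_smul

/-- The inclusion of `A` as the forms of degree zero. -/
noncomputable def ofAlg : A →ₐ[K] X.Form :=
  AlgHom.ofLinearMap (single ∅) rfl fun a b => by simp [single_mul_single]

theorem ofAlg_apply (a : A) : (ofAlg a : X.Form) = single ∅ a := rfl

@[simp] theorem single_mul_ofAlg (S : Finset I) (a b : A) :
    (single S a * ofAlg b : X.Form) = single S (a * b) := by
  simp [ofAlg_apply, single_mul_single]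

@[simp] theorem ofAlg_mul_single (S : Finset I) (a b : A) :
    (ofAlg a * single S b : X.Form) = single S (X.aut S a * b) := by
  simp [ofAlg_apply, single_mul_single]

theorem coord_mul_ofAlg (S : Finset I) (f : X.Form) (a : A) :
    coord S (f * ofAlg a) = coord S f * a := by
  induction f using induction with
  | add f g hf hg => rw [add_mul, map_add, hf, hg, map_add, add_mul]
  | single T b =>
    rw [single_mul_ofAlg, coord_single, coord_single]
    split_ifs <;> simp

theorem coord_ofAlg_mul (S : Finset I) (f : X.Form) (a : A) :
    coord S (ofAlg a * f) = X.aut S a * coord S f := by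
  induction f using induction with
  | add f g hf hg => rw [mul_add, map_add, hf, hg, map_add, mul_add]
  | single T b =>
    rw [ofAlg_mul_single, coord_single, coord_single]
    split_ifs with h
    · rw [h]
    · simp

/-- Forms of degree `n`: those supported on the subsets of `I` with `n` elements. -/
def gr (X : SkewFrame K A I) (n : ℕ) : Submodule K X.Form where
  carrier := {f | ∀ S : Finset I, S.card ≠ n → coord S f = 0}
  add_mem' := by
    intro f g hf hg S hS
    rw [map_add, hf S hS, hg S hS, add_zero]
  zero_mem' := by simp
  smul_mem' := by
    intro r f hf S hS
    rw [map_smul, hf S hS, smul_zero]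

theorem single_mem_gr {n : ℕ} {S : Finset I} (h : S.card = n) (a : A) :
    (single S a : X.Form) ∈ gr X n := by
  intro T hT
  rw [coord_single, if_neg]
  rintro rfl
  exact hT h

/-- To prove that a linear condition holds on forms of degree `n`, it is enough to consider
`(e S) a` with `S` of cardinality `n`. -/
theorem gr_le_of_single {n : ℕ} {P : Submodule K X.Form}
    (h : ∀ S : Finset I, S.card = n → ∀ a, single S a ∈ P) : gr X n ≤ P := by
  intro f hf
  rw [← sum_single f]
  refine Submodule.sum_mem _ fun S _ => ?_
  by_cases hS : S.card = n
  · exact h S hS _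
  · rw [hf S hS, map_zero]
    exact P.zero_mem

instance : SetLike.GradedMonoid (gr X) where
  one_mem := single_mem_gr Finset.card_empty 1
  mul_mem := by
    intro m n f g hf hg
    rw [mul_def]
    refine Submodule.sum_mem _ fun S _ => Submodule.sum_mem _ fun T _ => ?_
    by_cases hS : S.card = m
    · by_cases hT : T.card = n
      · by_cases h : Disjoint S T
        · exact Submodule.smul_mem _ _
            (single_mem_gr (by rw [Finset.card_union_of_disjoint h, hS, hT]) _)
        · simp [X.coeff_eq_zero h]
      · simp [hg T hT]
    · simp [hf S hS]

noncomputable instance : DirectSum.Decomposition (gr X) where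
  decompose' f := ∑ S : Finset I, DirectSum.of (fun n => gr X n) S.card
    ⟨single S (coord S f), single_mem_gr rfl _⟩
  left_inv f := by
    simp [sum_single]
  right_inv x := by
    induction x using DirectSum.induction_on with
    | zero =>
      simp only [map_zero]
      exact Finset.sum_eq_zero fun S _ => map_zero (DirectSum.of (fun n => gr X n) S.card)
    | add x y hx hy =>
      conv_rhs => rw [← hx, ← hy]
      rw [← Finset.sum_add_distrib]
      refine Finset.sum_congr rfl fun S _ => ?_
      rw [← map_add]
      congr 1
      apply Subtype.ext
      simp
    | of n f =>
      have key : ∀ S : Finset I, DirectSum.of (fun n => gr X n) S.card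
          ⟨single S (coord S (f : X.Form)), single_mem_gr rfl _⟩ =
          DirectSum.of (fun n => gr X n) n ⟨single S (coord S (f : X.Form)), by
            by_cases hS : S.card = n
            · exact single_mem_gr hS _
            · rw [f.2 S hS, map_zero]
              exact Submodule.zero_mem _⟩ := by
        intro S
        by_cases hS : S.card = n
        · subst hS
          rfl
        · have h₀ := f.2 S hS
          have h₁ : (single S (coord S (f : X.Form)) : X.Form) = 0 := by rw [h₀, map_zero]
          simp only [h₁]
          exact (map_zero (DirectSum.of (fun n => gr X n) S.card)).trans
            (map_zero (DirectSum.of (fun n => gr X n) n)).symm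
      simp only [DirectSum.coeAddMonoidHom_of, key]
      rw [← map_sum]
      congr 1
      apply Subtype.ext
      simp [sum_single]

noncomputable instance : GradedAlgebra (gr X) where

end Form

end SkewFrame

/-! ### The differential of a skew calculus -/

/-- Generators `x i` of `A` and skew derivations `pd i`, with `pd i (x j) = δ i j`, which define a
differential `d a = ∑ i, (e i) (pd i a)` on the twisted exterior algebra of a skew frame. The
automorphism `ν i` scales each generator and translates it by a constant. By `s_mul_θ`, the relation
between `(e i) (e j)` and `(e j) (e i)` is the one obtained by applying `d` to
`x j (e i) = (e i) (ν i (x j))`. -/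
structure SkewCalculus (K : Type u) (A : Type v) (I : Type) [Field K] [Ring A] [Algebra K A]
    [DecidableEq I] extends SkewFrame K A I where
  x : I → A
  adjoin_x : Algebra.adjoin K (Set.range x) = ⊤
  s : I → I → K
  r : I → I → K
  ν_x : ∀ i j, ν i (x j) = s i j • x j + algebraMap K A (r i j)
  s_mul_θ : ∀ i j, i ≠ j → s i j * θ i j = -θ j i
  pd : I → A →ₗ[K] A
  pd_mul : ∀ i a b, pd i (a * b) = pd i a * b + ν i a * pd i b
  pd_x : ∀ i j, pd i (x j) = if i = j then 1 else 0

/-- A twisted derivation that vanishes on generators of the algebra is zero. -/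
theorem LinearMap.eq_zero_of_skew_leibniz {K : Type u} {A : Type v} {I : Type} [Field K] [Ring A]
    [Algebra K A] {x : I → A} (hx : Algebra.adjoin K (Set.range x) = ⊤) (E : A →ₗ[K] A)
    (ρ τ : A → A) (hρ : ρ 1 = 1) (hτ : τ 1 = 1)
    (hE : ∀ a b, E (a * b) = E a * τ b + ρ a * E b) (h : ∀ i, E (x i) = 0)
    (a : A) : E a = 0 := by
  have h₁ : E 1 = 0 := by simpa [hρ, hτ] using hE 1 1
  have ha : a ∈ Algebra.adjoin K (Set.range x) := hx ▸ Algebra.mem_top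
  induction ha using Algebra.adjoin_induction with
  | mem y hy =>
    obtain ⟨i, rfl⟩ := hy
    exact h i
  | algebraMap r => rw [Algebra.algebraMap_eq_smul_one, map_smul, h₁, smul_zero]
  | add y z _ _ hy hz => rw [map_add, hy, hz, add_zero]
  | mul y z _ _ hy hz => rw [hE, hy, hz, zero_mul, mul_zero, add_zero]

namespace SkewCalculus

variable {K : Type u} {A : Type v} {I : Type} [Field K] [Ring A] [Algebra K A] [DecidableEq I]
variable (X : SkewCalculus K A I)

open SkewFrame SkewFrame.Form

theorem pd_one (i : I) : X.pd i 1 = 0 := by simpa using X.pd_mul i 1 1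

theorem pd_algebraMap (i : I) (r : K) : X.pd i (algebraMap K A r) = 0 := by
  rw [Algebra.algebraMap_eq_smul_one, map_smul, X.pd_one, smul_zero]

/-- The skew derivations commute with the automorphisms up to scalars. -/
theorem ν_pd {i j : I} (hij : i ≠ j) (a : A) :
    X.θ i j • X.ν j (X.pd i a) + X.θ j i • X.pd i (X.ν j a) = 0 := by
  refine LinearMap.eq_zero_of_skew_leibniz X.adjoin_x
    (X.θ i j • ((X.ν j).toLinearMap ∘ₗ X.pd i) + X.θ j i • (X.pd i ∘ₗ (X.ν j).toLinearMap))
    (fun a => X.ν j (X.ν i a)) (X.ν j) (by simp) (by simp) (fun a b => ?_) (fun k => ?_) a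
  · have hc : X.ν i (X.ν j a) = X.ν j (X.ν i a) := DFunLike.congr_fun (X.ν_comm i j) a
    simp only [LinearMap.add_apply, LinearMap.smul_apply, LinearMap.comp_apply,
      AlgEquiv.toLinearMap_apply, X.pd_mul, map_add, map_mul, hc, smul_add, add_mul, mul_add, smul_mul_assoc,
      mul_smul_comm]
    abel
  · have h := X.s_mul_θ j i hij.symm
    simp only [LinearMap.add_apply, LinearMap.smul_apply, LinearMap.comp_apply,
      AlgEquiv.toLinearMap_apply, X.ν_x, map_add, map_smul, X.pd_algebraMap, X.pd_x, add_zero]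
    split_ifs with hik
    · subst hik
      rw [map_one, smul_smul, mul_comm, h, neg_smul, add_neg_cancel]
    · simp

/-- The skew derivations commute up to scalars, which gives `d (d a) = 0`. -/
theorem pd_pd {i j : I} (hij : i ≠ j) (a : A) :
    X.θ i j • X.pd j (X.pd i a) + X.θ j i • X.pd i (X.pd j a) = 0 := by
  refine LinearMap.eq_zero_of_skew_leibniz X.adjoin_x
    (X.θ i j • (X.pd j ∘ₗ X.pd i) + X.θ j i • (X.pd i ∘ₗ X.pd j))
    (fun a => X.ν j (X.ν i a)) id (by simp) rfl (fun a b => ?_) (fun k => ?_) a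
  · have hc : X.ν i (X.ν j a) = X.ν j (X.ν i a) := DFunLike.congr_fun (X.ν_comm i j) a
    have h₁ := X.ν_pd hij a
    have h₂ := X.ν_pd hij.symm a
    simp only [LinearMap.add_apply, LinearMap.smul_apply, LinearMap.comp_apply,
      X.pd_mul, map_add, id, hc, smul_add, add_mul, mul_add, smul_mul_assoc,
      mul_smul_comm]
    -- The mixed terms cancel by `ν_pd`.
    have h₃ : X.θ i j • (X.ν j (X.pd i a) * X.pd j b) +
        X.θ j i • (X.pd i (X.ν j a) * X.pd j b) = 0 := by
      rw [← smul_mul_assoc, ← smul_mul_assoc, ← add_mul, h₁, zero_mul]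
    have h₄ : X.θ j i • (X.ν i (X.pd j a) * X.pd i b) +
        X.θ i j • (X.pd j (X.ν i a) * X.pd i b) = 0 := by
      rw [← smul_mul_assoc, ← smul_mul_assoc, ← add_mul, h₂, zero_mul]
    linear_combination (norm := module) h₃ + h₄
  · simp only [LinearMap.add_apply, LinearMap.smul_apply, LinearMap.comp_apply, X.pd_x]
    split_ifs <;> simp [X.pd_one]

/-- Scalar form of `d₀_mul_single_one` in the coordinate `i ∉ T`; it iterates `ν_pd` over `T`. -/
theorem aut_pd {i : I} {T : Finset I} (hi : i ∉ T) (a : A) :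
    X.coeff {i} T • X.aut T (X.pd i a) =
      (-1 : K) ^ T.card • X.coeff T {i} • X.pd i (X.aut T a) := by
  rw [coeff_singleton_left, coeff_singleton_right]
  induction T using Finset.induction_on generalizing a with
  | empty => simp
  | insert j T hj ih =>
    rw [Finset.mem_insert, not_or] at hi
    have h := ih hi.2 a
    have h' := X.ν_pd hi.1 (X.aut T a)
    rw [Finset.prod_insert hj, Finset.prod_insert hj, Finset.card_insert_of_notMem hj,
      X.aut_insert hj, AlgEquiv.mul_apply, AlgEquiv.mul_apply, mul_smul, ← map_smul (X.ν j), h,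
      map_smul, map_smul, smul_comm (X.θ i j), smul_comm (X.θ i j), eq_neg_of_add_eq_zero_left h',
      pow_succ]
    module

variable [Fintype I]

/-- The one-form `d a = ∑ i, (e i) (pd i a)`. -/
noncomputable def d₀ : A →ₗ[K] X.Form := ∑ i, single {i} ∘ₗ X.pd i

theorem d₀_apply (a : A) : X.d₀ a = ∑ i, single {i} (X.pd i a) := by
  simp [d₀, LinearMap.sum_apply]

theorem d₀_one : X.d₀ 1 = 0 := by simp [d₀_apply, X.pd_one]

theorem d₀_x (i : I) : X.d₀ (X.x i) = single {i} 1 := by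
  rw [d₀_apply, Finset.sum_eq_single i]
  · simp [X.pd_x]
  · intro j _ hj
    simp [X.pd_x, hj]
  · simp

theorem coord_d₀ (i : I) (a : A) : coord {i} (X.d₀ a) = X.pd i a := by
  rw [d₀_apply, map_sum, Finset.sum_eq_single i]
  · simp
  · intro j _ hj
    rw [coord_single, if_neg]
    simpa using hj.symm
  · simp

theorem d₀_mem_gr (a : A) : X.d₀ a ∈ gr X.toSkewFrame 1 := by
  rw [d₀_apply]
  exact Submodule.sum_mem _ fun i _ => single_mem_gr (Finset.card_singleton i) _

theorem d₀_mul (a b : A) : X.d₀ (a * b) = X.d₀ a * ofAlg b + ofAlg a * X.d₀ b := by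
  simp only [d₀_apply, Finset.sum_mul, Finset.mul_sum, single_mul_ofAlg, ofAlg_mul_single,
    aut_singleton, X.pd_mul, map_add, Finset.sum_add_distrib]

/-- Moving the one-form `d a` past a form `e T` with constant coefficients. -/
theorem d₀_mul_single_one (T : Finset I) (a : A) :
    X.d₀ a * single T 1 = (-1 : K) ^ T.card • (single T 1 * X.d₀ (X.aut T a)) := by
  simp only [d₀_apply, Finset.sum_mul, Finset.mul_sum, single_mul_single, map_one, mul_one,
    one_mul, Finset.smul_sum]
  refine Finset.sum_congr rfl fun i _ => ?_
  by_cases hi : i ∈ T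
  · rw [X.coeff_eq_zero (by simpa using hi), X.coeff_eq_zero (by simpa using hi), zero_smul,
      zero_smul, smul_zero]
  · rw [← map_smul (single ({i} ∪ T)), X.aut_pd hi, map_smul, map_smul, Finset.union_comm]

/-- The differential, `d ((e S) a) = (-1) ^ |S| (e S) (d a)`. -/
noncomputable def dForm : X.Form →ₗ[K] X.Form :=
  ∑ S : Finset I, (-1 : K) ^ S.card • (LinearMap.mulLeft K (single S 1) ∘ₗ X.d₀ ∘ₗ coord S)

theorem dForm_single (S : Finset I) (a : A) :
    X.dForm (single S a) = (-1 : K) ^ S.card • (single S 1 * X.d₀ a) := by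
  simp only [dForm, LinearMap.sum_apply]
  rw [Finset.sum_eq_single S]
  · simp
  · intro T _ hT
    simp [coord_single, hT]
  · simp

theorem dForm_ofAlg (a : A) : X.dForm (ofAlg a) = X.d₀ a := by
  rw [ofAlg_apply, dForm_single, ← one_def, one_mul, Finset.card_empty, pow_zero, one_smul]

theorem dForm_mem_gr (n : ℕ) (f : X.Form) (hf : f ∈ gr X.toSkewFrame n) :
    X.dForm f ∈ gr X.toSkewFrame (n + 1) := by
  refine gr_le_of_single (P := (gr X.toSkewFrame (n + 1)).comap X.dForm) (fun S hS a => ?_) hf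
  rw [Submodule.mem_comap, dForm_single]
  exact Submodule.smul_mem _ _ (SetLike.mul_mem_graded (single_mem_gr hS 1) (X.d₀_mem_gr a))

theorem single_eq (S : Finset I) (a : A) :
    (single S a : X.Form) = single S 1 * ofAlg a := by
  rw [single_mul_ofAlg, one_mul]

theorem dForm_single_mul (S : Finset I) (a : A) (g : X.Form) :
    X.dForm (single S a * g) =
      X.dForm (single S a) * g + (-1 : K) ^ S.card • (single S a * X.dForm g) := by
  induction g using Form.induction with
  | add g₁ g₂ h₁ h₂ =>
    simp only [mul_add, map_add, h₁, h₂, smul_add]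
    abel
  | single T b =>
    -- Both sides are reduced to `(e S) (e T) (d (ν_T a) b + ν_T a d b)`.
    have h₁ : X.dForm (single S a * single T b) = ((-1 : K) ^ S.card * (-1) ^ T.card) •
        (single S 1 * single T 1 * X.d₀ (X.aut T a * b)) := by
      rw [single_mul_single, single_mul_single, map_smul, dForm_single, smul_mul_assoc,
        map_one (X.aut T), one_mul]
      by_cases h : Disjoint S T
      · rw [Finset.card_union_of_disjoint h, pow_add, smul_comm]
      · simp [X.coeff_eq_zero h]
    have h₂ : (single S a : X.Form) * single T 1 = single S 1 * single T 1 * ofAlg (X.aut T a) := by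
      rw [single_mul_single, single_mul_single, smul_mul_assoc, single_mul_ofAlg]
      simp
    rw [h₁, d₀_mul, dForm_single, dForm_single, X.single_eq T b, smul_mul_assoc, mul_smul_comm,
      smul_smul, ← mul_assoc (single S a), h₂, mul_assoc (single S 1) (X.d₀ a),
      ← mul_assoc (X.d₀ a), d₀_mul_single_one]
    simp only [smul_mul_assoc, mul_smul_comm, smul_smul, mul_add, smul_add, mul_assoc]

theorem dForm_mul (n : ℕ) (f : X.Form) (hf : f ∈ gr X.toSkewFrame n) (g : X.Form) :
    X.dForm (f * g) = X.dForm f * g + (-1 : K) ^ n • (f * X.dForm g) := by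
  have h : gr X.toSkewFrame n ≤ LinearMap.eqLocus (X.dForm ∘ₗ LinearMap.mulRight K g)
      (LinearMap.mulRight K g ∘ₗ X.dForm +
        (-1 : K) ^ n • LinearMap.mulRight K (X.dForm g)) := by
    refine gr_le_of_single fun S hS a => ?_
    subst hS
    simpa using X.dForm_single_mul S a g
  simpa using h hf

theorem dForm_d₀ (a : A) : X.dForm (X.d₀ a) = 0 := by
  have h : X.dForm (X.d₀ a) =
      -∑ p : I × I, X.θ p.1 p.2 • single ({p.1} ∪ {p.2}) (X.pd p.2 (X.pd p.1 a)) := by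
    rw [d₀_apply, map_sum, ← Finset.sum_neg_distrib, Fintype.sum_prod_type]
    simp only [dForm_single, d₀_apply, Finset.mul_sum, single_mul_single]
    simp [coeff]
  rw [h, neg_eq_zero]
  refine Finset.sum_involution (fun p _ => p.swap) (fun p _ => ?_) (fun p _ hp => ?_)
    (fun _ _ => Finset.mem_univ _) (fun p _ => p.swap_swap)
  · by_cases hp : p.1 = p.2
    · simp [hp, X.θ_self]
    · rw [Prod.fst_swap, Prod.snd_swap, Finset.union_comm {p.2}, ← map_smul (single _),
        ← map_smul (single _), ← map_add, X.pd_pd hp, map_zero]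
  · intro h
    have h' : p.2 = p.1 := congrArg Prod.fst h
    rw [h', X.θ_self, zero_smul] at hp
    exact hp rfl

theorem dForm_dForm (f : X.Form) : X.dForm (X.dForm f) = 0 := by
  induction f using Form.induction with
  | add f g hf hg => rw [map_add, map_add, hf, hg, add_zero]
  | single S a =>
    rw [dForm_single, map_smul, dForm_single_mul, dForm_single, d₀_one, dForm_d₀]
    simp

/-- The differential graded algebra of a skew calculus. -/
noncomputable abbrev dgAlgebra : DGAlgebra.{u, v} K where
  carrier := X.Form
  gr := gr X.toSkewFrame
  d := X.dForm
  d_mem := X.dForm_mem_gr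
  leibniz := X.dForm_mul
  d_d := X.dForm_dForm

theorem single_one_mem_pow (S : Finset I) :
    (single S 1 : X.Form) ∈
      (LinearMap.range (X.dForm ∘ₗ (ofAlg : A →ₐ[K] X.Form).toLinearMap)) ^ S.card := by
  induction S using Finset.induction_on with
  | empty =>
    rw [Finset.card_empty, pow_zero, ← one_def]
    exact Submodule.one_le.1 le_rfl
  | insert i S hi ih =>
    have hd : Disjoint {i} S := by simpa using hi
    have h : (single (insert i S) 1 : X.Form) =
        (X.coeff {i} S)⁻¹ • (single {i} 1 * single S 1) := by
      rw [single_mul_single, smul_smul, inv_mul_cancel₀ (X.coeff_ne_zero hd), one_smul,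
        map_one (X.aut S), one_mul, Finset.insert_eq]
    rw [h, Finset.card_insert_of_notMem hi, pow_succ']
    refine Submodule.smul_mem _ _ (Submodule.mul_mem_mul ⟨X.x i, ?_⟩ ih)
    simp [dForm_ofAlg, d₀_x]

theorem gr_eq (n : ℕ) : gr X.toSkewFrame n =
    LinearMap.range (ofAlg : A →ₐ[K] X.Form).toLinearMap *
      (LinearMap.range (X.dForm ∘ₗ (ofAlg : A →ₐ[K] X.Form).toLinearMap)) ^ n := by
  apply le_antisymm
  · refine gr_le_of_single fun S hS a => ?_
    have h : (single S a : X.Form) = ofAlg ((X.aut S).symm a) * single S 1 := by simp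
    rw [h, ← hS]
    exact Submodule.mul_mem_mul ⟨_, rfl⟩ (X.single_one_mem_pow S)
  · have hR : LinearMap.range (X.dForm ∘ₗ (ofAlg : A →ₐ[K] X.Form).toLinearMap) ≤
        gr X.toSkewFrame 1 := by
      rintro _ ⟨a, rfl⟩
      simpa [dForm_ofAlg] using X.d₀_mem_gr a
    have hpow : ∀ n : ℕ, (gr X.toSkewFrame 1) ^ n ≤ gr X.toSkewFrame n := by
      intro n
      induction n with
      | zero =>
        rw [pow_zero, Submodule.one_le]
        exact SetLike.GradedOne.one_mem
      | succ n ih =>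
        rw [pow_succ, Submodule.mul_le]
        exact fun f hf g hg => SetLike.mul_mem_graded (ih hf) hg
    rw [Submodule.mul_le]
    rintro _ ⟨a, rfl⟩ g hg
    have hg' := hpow n (pow_le_pow_left' hR n hg)
    have ha : (ofAlg a : X.Form) ∈ gr X.toSkewFrame 0 := single_mem_gr Finset.card_empty a
    simpa using SetLike.mul_mem_graded ha hg'

/-- The differential calculus of a skew calculus. -/
noncomputable abbrev calculus : DifferentialCalculus K A where
  toDGAlgebra := X.dgAlgebra
  ι := (ofAlg : A →ₐ[K] X.Form)
  ι_injective := fun a b h => by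
    have h' := congrArg (coord ∅) (show (single ∅ a : X.Form) = single ∅ b from h)
    simpa using h'
  gr_eq := X.gr_eq

end SkewCalculus

/-! ### Integration from a nondegenerate pairing -/

namespace DifferentialCalculus

variable {K : Type u} [Field K] {A : Type v} [Ring A] [Algebra K A]

/-- The pairing `ω ↦ (η ↦ π (ω ∧ η))` of `Ω^k` with `Ω^m`, for a right `A`-linear map `π` on
forms. -/
def pairing (Ω : DifferentialCalculus K A) (π : Ω.carrier →ₗ[K] A)
    (hπ : ∀ ω a, π (ω * Ω.ι a) = π ω * a) (k m : ℕ) : Ω.gr k →ₗ[K] Ω.IntegralForms m where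
  toFun ω := ⟨π ∘ₗ LinearMap.mulLeft K (ω : Ω.carrier) ∘ₗ (Ω.gr m).subtype, fun η a => by
    simp [← mul_assoc, hπ]⟩
  map_add' ω ω' := by
    ext η
    simp [add_mul]
  map_smul' r ω := by
    ext η
    simp

variable {Ω : DifferentialCalculus K A} {π : Ω.carrier →ₗ[K] A}
  {hπ : ∀ ω a, π (ω * Ω.ι a) = π ω * a}

@[simp] theorem pairing_apply {k m : ℕ} (ω : Ω.gr k) (η : Ω.gr m) :
    (Ω.pairing π hπ k m ω).1 η = π (ω * η) := rfl

theorem IntegralForms.ext {m : ℕ} {φ ψ : Ω.IntegralForms m} (h : ∀ η, φ.1 η = ψ.1 η) : φ = ψ :=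
  Subtype.ext (LinearMap.ext h)

theorem pairing_rmul {k m : ℕ} (ω : Ω.gr k) (a : A) :
    Ω.pairing π hπ k m (Ω.rmul k a ω) = ract (Ω.pairing π hπ k m ω) a :=
  IntegralForms.ext fun η => congrArg π (mul_assoc (ω : Ω.carrier) (Ω.ι a) η)

theorem act_pairing {k m l : ℕ} (ω : Ω.gr k) (η : Ω.gr m) :
    act (Ω.pairing π hπ k (m + l) ω) η = Ω.pairing π hπ (k + m) l (Ω.wedge ω m η) :=
  IntegralForms.ext fun ζ => congrArg π (mul_assoc (ω : Ω.carrier) η ζ).symm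

/-- The divergence `∇` with `∇ (π (ω ∧ -)) = π (d ω)` for `ω` of even degree `N`, when every
integral form of degree one is `π (ω ∧ -)` for a unique `ω` of degree `N`. -/
noncomputable def divergenceOfPairing {N : ℕ} (hN : Even N)
    (h : Function.Bijective (Ω.pairing π hπ N 1)) : Divergence Ω where
  toFun := π ∘ₗ Ω.d ∘ₗ (Ω.gr N).subtype ∘ₗ
    ((LinearEquiv.ofBijective _ h).symm : Ω.IntegralForms 1 →ₗ[K] Ω.gr N)
  map_ract φ a := by
    obtain ⟨ω, rfl⟩ := h.2 φ
    have h' : ∀ ω, (LinearEquiv.ofBijective _ h).symm (Ω.pairing π hπ N 1 ω) = ω :=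
      (LinearEquiv.ofBijective _ h).symm_apply_apply
    have hl := Ω.leibniz N ω ω.2 (Ω.ι a)
    rw [hN.neg_one_pow, one_smul] at hl
    simp only [← pairing_rmul, LinearMap.comp_apply, LinearEquiv.coe_coe, h',
      Submodule.subtype_apply, coe_rmul, hl, map_add, hπ, pairing_apply]
    rfl

theorem divergenceOfPairing_pairing {N : ℕ} (hN : Even N)
    (h : Function.Bijective (Ω.pairing π hπ N 1)) (ω : Ω.gr N) :
    (divergenceOfPairing hN h).toFun (Ω.pairing π hπ N 1 ω) = π (Ω.d ω) :=
  congrArg (fun ω : Ω.gr N => π (Ω.d ω)) ((LinearEquiv.ofBijective _ h).symm_apply_apply ω)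

/-- Under the pairing, the complex of integral forms becomes the de Rham complex. No signs appear
because the top degree `k + m + 1` is odd. -/
theorem ext_pairing {N k m : ℕ} (hN : Even N) (hkm : k + m = N)
    (h : Function.Bijective (Ω.pairing π hπ N 1)) (ω : Ω.gr k) :
    (divergenceOfPairing hN h).ext m (Ω.pairing π hπ k (m + 1) ω) =
      Ω.pairing π hπ (k + 1) m (Ω.dGr k ω) := by
  subst hkm
  refine IntegralForms.ext fun η => ?_
  have hs : (-1 : K) ^ k = (-1) ^ m := by
    rcases Nat.even_add.1 hN with hkm
    by_cases hk : Even k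
    · rw [hk.neg_one_pow, (hkm.1 hk).neg_one_pow]
    · rw [(Nat.not_even_iff_odd.1 hk).neg_one_pow,
        (Nat.not_even_iff_odd.1 fun hm => hk (hkm.2 hm)).neg_one_pow]
  change (divergenceOfPairing hN h).toFun (act (Ω.pairing π hπ k (m + 1) ω) η) +
    (-1 : K) ^ (m + 1) • π (ω * Ω.d η) = π (Ω.d ω * η)
  rw [act_pairing, divergenceOfPairing_pairing, coe_wedge, Ω.leibniz k ω ω.2, map_add, map_smul,
    hs, pow_succ]
  module

/-- A right `A`-linear functional `π` on forms, which is left `A`-linear up to an automorphism `σ`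
and pairs `Ω^k` perfectly with `Ω^(n-k)`, makes a calculus of odd dimension `n = N + 2`
integrable. -/
noncomputable def integrationOfPairing {N : ℕ} (hN : Odd N) (σ : A ≃ₐ[K] A)
    (hσ : ∀ ω a, π (Ω.ι a * ω) = σ a * π ω)
    (h : ∀ k m, k + m = N + 2 → Function.Bijective (Ω.pairing π hπ k m)) :
    Integration Ω (N + 2) where
  div := divergenceOfPairing hN.add_one (h (N + 1) 1 rfl)
  flat φ := by
    obtain ⟨ω, rfl⟩ := (h N 2 rfl).2 φ
    rw [ext_pairing _ rfl, divergenceOfPairing_pairing]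
    simp [Ω.d_d]
  σ := σ
  Θ k m hkm := LinearEquiv.ofBijective _ (h k m hkm)
  Θ_lmul k m hkm a ω := IntegralForms.ext fun η =>
    (congrArg π (mul_assoc (Ω.ι a) (ω : Ω.carrier) η)).trans (hσ _ a)
  Θ_rmul k m hkm a ω := pairing_rmul (hπ := hπ) ω a
  Θ_d k m hkm _ ω := (ext_pairing _ (Nat.succ_injective hkm) _ ω).symm

end DifferentialCalculus

/-! ### Properties of the calculus of a skew calculus -/

namespace SkewFrame.Form

variable {K : Type u} {A : Type v} {I : Type} [Field K] [Ring A] [Algebra K A]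
variable {X : SkewFrame K A I} [Fintype I] [DecidableEq I]

theorem coord_univ_mul_single (f : X.Form) (T : Finset I) (b : A) :
    coord Finset.univ (f * single T b) = X.coeff Tᶜ T • (X.aut T (coord Tᶜ f) * b) := by
  induction f using Form.induction with
  | add f g hf hg => simp only [add_mul, map_add, hf, hg, smul_add]
  | single S a =>
    rw [single_mul_single, map_smul, coord_single, coord_single]
    by_cases h : Tᶜ = S
    · subst h
      rw [if_pos (by rw [Finset.union_comm, Finset.union_compl]), if_pos rfl]
    · rw [if_neg h, map_zero, zero_mul, smul_zero]
      by_cases hd : Disjoint S T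
      · rw [if_neg, smul_zero]
        intro hu
        refine h ?_
        exact (IsCompl.of_eq (disjoint_iff.1 hd) hu.symm).symm.compl_eq
      · rw [X.coeff_eq_zero hd, zero_smul]

end SkewFrame.Form

namespace SkewCalculus

variable {K : Type u} {A : Type v} {I : Type} [Field K] [Ring A] [Algebra K A] [DecidableEq I]
variable (X : SkewCalculus K A I) [Fintype I]

open SkewFrame SkewFrame.Form

theorem dOf_eq (a : A) : X.calculus.dOf a = X.d₀ a := X.dForm_ofAlg a

theorem dOf_x (i : I) : X.calculus.dOf (X.x i) = (single {i} 1 : X.Form) :=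
  (X.dOf_eq _).trans (X.d₀_x i)

theorem dOf_eq_zero_iff (a : A) : X.calculus.dOf a = 0 ↔ ∀ i, X.pd i a = 0 := by
  rw [dOf_eq]
  constructor
  · intro h i
    rw [← X.coord_d₀]
    exact (congrArg (coord {i}) h).trans (map_zero _)
  · intro h
    rw [d₀_apply]
    exact Finset.sum_eq_zero fun i _ => by rw [h i, map_zero]

theorem ι_mul_dOf_x (i : I) (a : A) :
    X.calculus.ι a * X.calculus.dOf (X.x i) =
      X.calculus.dOf (X.x i) * X.calculus.ι (X.ν i a) := by
  rw [dOf_x]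
  refine (ofAlg_mul_single {i} a 1).trans (Eq.trans ?_ (single_mul_ofAlg {i} 1 (X.ν i a)).symm)
  simp

theorem dOf_x_mul_dOf_x (i j : I) :
    X.calculus.dOf (X.x i) * X.calculus.dOf (X.x j) =
      X.θ i j • (single {i, j} 1 : X.Form) := by
  rw [dOf_x, dOf_x]
  refine (single_mul_single {i} {j} 1 1).trans ?_
  rw [Finset.insert_eq]
  simp [coeff]

theorem hasDimension [Nontrivial A] : X.calculus.HasDimension (Fintype.card I) := by
  constructor
  · intro h
    have h₁ : (single Finset.univ 1 : X.Form) ∈ gr X.toSkewFrame (Fintype.card I) :=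
      single_mem_gr Finset.card_univ 1
    have h₂ : (single Finset.univ 1 : X.Form) = 0 := (Submodule.eq_bot_iff _).1 h _ h₁
    have h₃ := congrArg (coord Finset.univ) h₂
    rw [coord_single_same, map_zero] at h₃
    exact one_ne_zero h₃
  · intro m hm
    refine (Submodule.eq_bot_iff _).2 fun f hf => Form.ext (X := X.toSkewFrame) fun S => ?_
    rw [map_zero]
    exact hf S ((Finset.card_le_univ S).trans_lt hm).ne

/-- The forms `e S`, with `S` ranging over the subsets of `I` with `n` elements, are a basis of the
forms of degree `n`. -/
theorem isRightBasis {J : Type} [Fintype J] {n : ℕ} (S : J → Finset I) (e : J → X.Form)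
    (he : ∀ j, e j = single (S j) 1) (hS : Function.Injective S)
    (hn : ∀ T : Finset I, T.card = n ↔ ∃ j, S j = T) : X.calculus.IsRightBasis n e := by
  have hsum : ∀ f : J → A, ∑ j, e j * (ofAlg (f j) : X.Form) = ∑ j, single (S j) (f j) := by
    intro f
    refine Finset.sum_congr rfl fun j _ => ?_
    rw [he, single_mul_ofAlg, one_mul]
  have hcoord : ∀ (f : J → A) (j : J),
      coord (S j) (∑ j, single (S j) (f j) : X.Form) = f j := by
    intro f j
    rw [map_sum, Finset.sum_eq_single j]
    · simp
    · intro k _ hk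
      rw [coord_single, if_neg fun h => hk (hS h).symm]
    · simp
  refine ⟨fun j => ?_, fun f hf => ⟨fun j => coord (X := X.toSkewFrame) (S j) f, ?_, fun g hg => ?_⟩⟩
  · rw [he]
    exact single_mem_gr ((hn _).2 ⟨j, rfl⟩) 1
  · refine Eq.trans ?_ (hsum _).symm
    refine Form.ext (X := X.toSkewFrame) fun T => ?_
    by_cases hT : T.card = n
    · obtain ⟨j, rfl⟩ := (hn T).1 hT
      rw [hcoord]
    · rw [hf T hT, map_sum, Finset.sum_eq_zero]
      intro j _
      rw [coord_single, if_neg]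
      rintro rfl
      exact hT ((hn _).2 ⟨j, rfl⟩)
  · funext j
    rw [hg.trans (hsum g), hcoord]

theorem eq_single_univ {f : X.Form} (hf : f ∈ gr X.toSkewFrame (Fintype.card I)) :
    f = single Finset.univ (coord Finset.univ f) := by
  refine Form.ext (X := X.toSkewFrame) fun S => ?_
  rw [coord_single]
  split_ifs with h
  · rw [h]
  · exact hf S fun hS => h ((Finset.card_eq_iff_eq_univ S).1 hS)

theorem isVolumeForm : X.calculus.IsVolumeForm (Fintype.card I) (single Finset.univ 1 : X.Form) := by
  refine ⟨single_mem_gr Finset.card_univ 1, fun f hf => ⟨coord (X := X.toSkewFrame) Finset.univ f, ?_, fun a ha => ?_⟩,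
    fun f hf => ⟨(X.aut Finset.univ).symm (coord (X := X.toSkewFrame) Finset.univ f), ?_, fun a ha => ?_⟩⟩
  · refine (X.eq_single_univ hf).trans (Eq.trans ?_ (single_mul_ofAlg _ _ _).symm)
    rw [one_mul]
  · have h := congrArg (coord (X := X.toSkewFrame) Finset.univ) (ha.trans (single_mul_ofAlg _ _ _))
    rw [coord_single_same, one_mul] at h
    exact h.symm
  · refine (X.eq_single_univ hf).trans (Eq.trans ?_ (ofAlg_mul_single _ _ _).symm)
    rw [AlgEquiv.apply_symm_apply, mul_one]
  · have h := congrArg (coord (X := X.toSkewFrame) Finset.univ) (ha.trans (ofAlg_mul_single _ _ _))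
    rw [coord_single_same, mul_one] at h
    rw [h, AlgEquiv.symm_apply_apply]

/-- The pairing of complementary degrees given by the coefficient of the top form is perfect. -/
theorem bijective_pairing {k m : ℕ} (h : k + m = Fintype.card I) :
    Function.Bijective (X.calculus.pairing (coord Finset.univ : X.Form →ₗ[K] A)
      (coord_mul_ofAlg Finset.univ) k m) := by
  constructor
  · rw [injective_iff_map_eq_zero]
    intro ω hω
    refine Subtype.ext (Form.ext (X := X.toSkewFrame) fun S => ?_)
    by_cases hS : S.card = k
    · have hT : Sᶜ.card = m := by rw [Finset.card_compl, hS]; omega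
      have h₀ : coord (X := X.toSkewFrame) Finset.univ
          ((ω : X.Form) * (single Sᶜ 1 : X.Form)) = 0 :=
        congrArg (fun φ : X.calculus.IntegralForms m => φ.1 ⟨single Sᶜ 1, single_mem_gr hT 1⟩) hω
      rw [coord_univ_mul_single, compl_compl, mul_one] at h₀
      have h₁ := (smul_eq_zero_iff_right (X.coeff_ne_zero disjoint_compl_right)).1 h₀
      rw [(map_eq_zero_iff _ (X.aut Sᶜ).injective).1 h₁]
      rfl
    · exact (ω.2 S hS).trans (map_zero _).symm
  · intro φ
    let v : Finset I → A := fun S => if hS : Sᶜ.card = m then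
      (X.aut Sᶜ).symm ((X.coeff S Sᶜ)⁻¹ • φ.1 ⟨single Sᶜ 1, single_mem_gr hS 1⟩) else 0
    let f : X.Form := ∑ S, single S (v S)
    have hv : ∀ S, coord S f = v S := by
      intro S
      rw [map_sum, Finset.sum_eq_single S]
      · simp
      · intro T _ hT
        rw [coord_single, if_neg hT.symm]
      · simp
    have hf : f ∈ gr X.toSkewFrame k := by
      intro S hS
      rw [hv]
      refine dif_neg fun hS' => hS ?_
      have := Finset.card_add_card_compl S
      omega
    have hle : gr X.toSkewFrame m ≤ (LinearMap.eqLocus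
        (X.calculus.pairing (coord Finset.univ : X.Form →ₗ[K] A)
          (coord_mul_ofAlg Finset.univ) k m ⟨f, hf⟩).1 φ.1).map (gr X.toSkewFrame m).subtype := by
      refine gr_le_of_single fun T hT a => ⟨⟨single T a, single_mem_gr hT a⟩, ?_, rfl⟩
      have hφ : φ.1 ⟨single T a, single_mem_gr hT a⟩ =
          φ.1 ⟨single T 1, single_mem_gr hT 1⟩ * a := by
        rw [← φ.2]
        refine congrArg φ.1 (Subtype.ext ?_)
        exact X.single_eq T a
      have hvT : v Tᶜ = (X.aut T).symm
          ((X.coeff Tᶜ T)⁻¹ • φ.1 ⟨single T 1, single_mem_gr hT 1⟩) := by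
        simp only [v, compl_compl, hT, dif_pos]
      change coord Finset.univ (f * single T a) = φ.1 ⟨single T a, single_mem_gr hT a⟩
      rw [coord_univ_mul_single, hv, hvT, AlgEquiv.apply_symm_apply, smul_mul_assoc, smul_smul,
        mul_inv_cancel₀ (X.coeff_ne_zero disjoint_compl_left), one_smul, hφ]
    refine ⟨⟨f, hf⟩, DifferentialCalculus.IntegralForms.ext fun η => ?_⟩
    obtain ⟨η', h₁, h₂⟩ := hle η.2
    rw [← show η' = η from Subtype.ext h₂]
    exact h₁

/-- In odd dimension the top form `e univ` is an integrating volume form. -/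
theorem isIntegratingForm {N : ℕ} (hN : Odd N) (h : Fintype.card I = N + 2) :
    X.calculus.IsIntegratingForm (N + 2) (single Finset.univ 1 : X.Form) := by
  refine ⟨DifferentialCalculus.integrationOfPairing hN (X.aut Finset.univ)
    (fun f a => coord_ofAlg_mul Finset.univ f a)
    fun k m hkm => X.bijective_pairing (hkm.trans h.symm),
    single_mem_gr (Finset.card_univ.trans h) 1, ?_⟩
  change coord Finset.univ ((single Finset.univ 1 : X.Form) * 1) = 1
  rw [mul_one, coord_single_same]

end SkewCalculus

/-! ### Relations and scalar identities of a bi-quadratic algebra -/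

/-- The conditions on scalars under which the substitution `x ↦ s' x + t'`, `y ↦ s y + t` preserves
the relation `y x = q x y + u x + v y + w`. -/
structure AffineCompatible {K : Type u} [Field K] (q u v w s' t' s t : K) : Prop where
  left : s * u + t = q * t + u
  right : s' * v + t' = q * t' + v
  const : s * s' * w + t * t' = q * t * t' + u * t' + v * t + w

namespace AffineCompatible

variable {K : Type u} [Field K] {q u v w s' t' s t : K}

theorem inv (h : AffineCompatible q u v w s' t' s t) (hs' : s' ≠ 0) (hs : s ≠ 0) :
    AffineCompatible q u v w s'⁻¹ (-(s'⁻¹ * t')) s⁻¹ (-(s⁻¹ * t)) where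
  left := by
    field_simp
    linear_combination -h.left
  right := by
    field_simp
    linear_combination -h.right
  const := by
    field_simp
    linear_combination -h.const + t' * h.left + t * h.right

theorem relation (h : AffineCompatible q u v w s' t' s t) {A : Type v} [Ring A] [Algebra K A]
    {x y : A} (hxy : y * x = q • (x * y) + u • x + v • y + w • (1 : A)) :
    (s • y + t • (1 : A)) * (s' • x + t' • (1 : A)) =
      q • ((s' • x + t' • (1 : A)) * (s • y + t • (1 : A))) + u • (s' • x + t' • (1 : A)) +
        v • (s • y + t • (1 : A)) + w • (1 : A) := by
  simp only [mul_add, add_mul, smul_mul_assoc, mul_smul_comm, mul_one, one_mul, hxy]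
  match_scalars
  · ring
  · linear_combination s' * h.left
  · linear_combination s * h.right
  · linear_combination h.const

end AffineCompatible

namespace BiquadraticData

variable {K : Type u} [Field K] (D : BiquadraticData K)

/-- The three generators as a family. -/
noncomputable def gen : Fin 3 → D.Alg := ![D.x₁, D.x₂, D.x₃]

theorem mkAlgHom_ι (i : Fin 3) :
    RingQuot.mkAlgHom K (D.Rel (FreeAlgebra.ι K)) (FreeAlgebra.ι K i) = D.gen i := by
  fin_cases i <;> rfl

theorem adjoin_gen : Algebra.adjoin K (Set.range D.gen) = ⊤ := by
  have h : Set.range D.gen = RingQuot.mkAlgHom K (D.Rel (FreeAlgebra.ι K)) ''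
      Set.range (FreeAlgebra.ι K) := by
    rw [← Set.range_comp]
    exact congrArg Set.range (funext fun i => (D.mkAlgHom_ι i).symm)
  rw [h, Algebra.adjoin_image, FreeAlgebra.adjoin_range_ι, Algebra.map_top,
    AlgHom.range_eq_top]
  exact RingQuot.mkAlgHom_surjective K _

instance : Algebra.FiniteType K D.Alg :=
  ⟨Subalgebra.fg_def.2 ⟨_, Set.finite_range D.gen, D.adjoin_gen⟩⟩

variable {D}

theorem algHom_ext {B : Type v} [Ring B] [Algebra K B] {f g : D.Alg →ₐ[K] B}
    (h : ∀ i, f (D.gen i) = g (D.gen i)) : f = g := by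
  refine AlgHom.ext_of_adjoin_eq_top D.adjoin_gen ?_
  rintro _ ⟨i, rfl⟩
  exact h i

section Relations

variable (hc : D.c = 0) (hβ : D.β = 0) (hlam : D.lam = 0)
include hc in
theorem x₂_mul_x₁ :
    D.x₂ * D.x₁ = D.q₁ • (D.x₁ * D.x₂) + D.a • D.x₁ + D.b • D.x₂ + D.b₁ • (1 : D.Alg) := by
  have h := RingQuot.mkAlgHom_rel K (Rel.rel₁ (D := D) (X := FreeAlgebra.ι K))
  simp only [map_sub, map_add, map_mul, map_smul, map_one, hc, zero_smul, add_zero,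
    Algebra.algebraMap_eq_smul_one] at h
  exact (sub_eq_iff_eq_add.1 h).trans (by simp only [x₁, x₂]; abel)

include hβ in
theorem x₃_mul_x₁ :
    D.x₃ * D.x₁ = D.q₂ • (D.x₁ * D.x₃) + D.α • D.x₁ + D.γ • D.x₃ + D.b₂ • (1 : D.Alg) := by
  have h := RingQuot.mkAlgHom_rel K (Rel.rel₂ (D := D) (X := FreeAlgebra.ι K))
  simp only [map_sub, map_add, map_mul, map_smul, map_one, hβ, zero_smul, add_zero,
    Algebra.algebraMap_eq_smul_one] at h
  exact (sub_eq_iff_eq_add.1 h).trans (by simp only [x₁, x₃]; abel)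

include hlam in
theorem x₃_mul_x₂ :
    D.x₃ * D.x₂ = D.q₃ • (D.x₂ * D.x₃) + D.μ • D.x₂ + D.ν • D.x₃ + D.b₃ • (1 : D.Alg) := by
  have h := RingQuot.mkAlgHom_rel K (Rel.rel₃ (D := D) (X := FreeAlgebra.ι K))
  simp only [map_sub, map_add, map_mul, map_smul, map_one, hlam, zero_smul, zero_add,
    Algebra.algebraMap_eq_smul_one] at h
  exact (sub_eq_iff_eq_add.1 h).trans (by simp only [x₂, x₃]; abel)

include hc hβ hlam

/-- The universal property of the algebra. -/
theorem exists_lift {B : Type v} [Ring B] [Algebra K B] {y₁ y₂ y₃ : B}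
    (h₁ : y₂ * y₁ = D.q₁ • (y₁ * y₂) + D.a • y₁ + D.b • y₂ + D.b₁ • (1 : B))
    (h₂ : y₃ * y₁ = D.q₂ • (y₁ * y₃) + D.α • y₁ + D.γ • y₃ + D.b₂ • (1 : B))
    (h₃ : y₃ * y₂ = D.q₃ • (y₂ * y₃) + D.μ • y₂ + D.ν • y₃ + D.b₃ • (1 : B)) :
    ∃ f : D.Alg →ₐ[K] B, f D.x₁ = y₁ ∧ f D.x₂ = y₂ ∧ f D.x₃ = y₃ := by
  let F : FreeAlgebra K (Fin 3) →ₐ[K] B := FreeAlgebra.lift K ![y₁, y₂, y₃]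
  have hF : ∀ p q, D.Rel (FreeAlgebra.ι K) p q → F p = F q := by
    rintro _ _ (_ | _ | _)
    · simp [F, h₁, hc, Algebra.algebraMap_eq_smul_one]
      abel
    · simp [F, h₂, hβ, Algebra.algebraMap_eq_smul_one]
      abel
    · simp [F, h₃, hlam, Algebra.algebraMap_eq_smul_one]
      abel
  refine ⟨RingQuot.liftAlgHom K ⟨F, fun p q => hF p q⟩, ?_, ?_, ?_⟩
  · simp [x₁, F]
  · simp [x₂, F]
  · simp [x₃, F]

/-- Coefficients of `x₁ x₂`, `x₁ x₃`, `x₂ x₃`, `x₁`, `x₂`, `x₃` in the identity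
`x₃ (x₂ x₁) = (x₃ x₂) x₁`: the consequences of the PBW property for the structure constants. -/
theorem overlap (hPBW : D.HasPBWBasis) :
    D.μ * (D.q₂ - 1) = D.α * (D.q₃ - 1) ∧ D.ν * (D.q₁ - 1) = D.a * (D.q₃ - 1) ∧
    D.γ * (D.q₁ - 1) = D.b * (D.q₂ - 1) ∧
    D.q₁ * D.q₂ * D.b₃ + D.a * D.α = D.q₃ * D.α * D.a + D.μ * D.a + D.ν * D.α + D.b₃ ∧
    D.q₁ * D.γ * D.μ + D.q₁ * D.b₂ = D.q₃ * D.α * D.b + D.q₃ * D.b₂ ∧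
    D.q₁ * D.γ * D.ν + D.a * D.γ + D.b * D.ν + D.b₁ = D.q₃ * D.q₂ * D.b₁ + D.ν * D.γ := by
  have R₁ := x₂_mul_x₁ hc
  have R₂ := x₃_mul_x₁ hβ
  have R₃ := x₃_mul_x₂ hlam
  have R₁' : ∀ z, D.x₂ * (D.x₁ * z) = D.q₁ • (D.x₁ * (D.x₂ * z)) + D.a • (D.x₁ * z) +
      D.b • (D.x₂ * z) + D.b₁ • z := fun z => by
    rw [← mul_assoc, R₁]
    simp only [add_mul, smul_mul_assoc, mul_assoc, one_mul]
  have R₂' : ∀ z, D.x₃ * (D.x₁ * z) = D.q₂ • (D.x₁ * (D.x₃ * z)) + D.α • (D.x₁ * z) +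
      D.γ • (D.x₃ * z) + D.b₂ • z := fun z => by
    rw [← mul_assoc, R₂]
    simp only [add_mul, smul_mul_assoc, mul_assoc, one_mul]
  have h : D.x₃ * (D.q₁ • (D.x₁ * D.x₂) + D.a • D.x₁ + D.b • D.x₂ + D.b₁ • (1 : D.Alg)) =
      (D.q₃ • (D.x₂ * D.x₃) + D.μ • D.x₂ + D.ν • D.x₃ + D.b₃ • (1 : D.Alg)) * D.x₁ := by
    rw [← R₁, ← R₃, mul_assoc]
  simp only [mul_add, add_mul, mul_smul_comm, smul_mul_assoc, mul_assoc, mul_one, one_mul,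
    R₁, R₂, R₃, R₁', R₂'] at h
  let e : Fin 7 → ℕ × ℕ × ℕ :=
    ![(1, 1, 0), (1, 0, 1), (0, 1, 1), (1, 0, 0), (0, 1, 0), (0, 0, 1), (0, 0, 0)]
  have he : Function.Injective e := by decide
  have hli := Fintype.linearIndependent_iff.1 (hPBW.1.comp e he) ![
    D.q₁ * D.q₂ * D.μ + D.q₁ * D.α - (D.q₃ * D.α * D.q₁ + D.μ * D.q₁),
    D.q₁ * D.q₂ * D.ν + D.a * D.q₂ - (D.q₃ * D.q₂ * D.a + D.ν * D.q₂),
    D.q₁ * D.γ * D.q₃ + D.b * D.q₃ - (D.q₃ * D.q₂ * D.b + D.q₃ * D.γ),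
    D.q₁ * D.q₂ * D.b₃ + D.a * D.α - (D.q₃ * D.α * D.a + D.μ * D.a + D.ν * D.α + D.b₃),
    D.q₁ * D.γ * D.μ + D.q₁ * D.b₂ - (D.q₃ * D.α * D.b + D.q₃ * D.b₂),
    D.q₁ * D.γ * D.ν + D.a * D.γ + D.b * D.ν + D.b₁ - (D.q₃ * D.q₂ * D.b₁ + D.ν * D.γ),
    D.q₁ * D.γ * D.b₃ + D.a * D.b₂ + D.b * D.b₃ -
      (D.q₃ * D.α * D.b₁ + D.μ * D.b₁ + D.ν * D.b₂)] (by
    simp [Fin.sum_univ_seven, e, monomial]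
    linear_combination (norm := module) h)
  have g₀ := hli 0
  have g₁ := hli 1
  have g₂ := hli 2
  have g₃ := hli 3
  have g₄ := hli 4
  have g₅ := hli 5
  simp at g₀ g₁ g₂ g₃ g₄ g₅
  refine ⟨mul_left_cancel₀ D.q₁_ne_zero ?_, mul_left_cancel₀ D.q₂_ne_zero ?_,
    mul_left_cancel₀ D.q₃_ne_zero ?_, ?_, ?_, ?_⟩
  · linear_combination g₀
  · linear_combination g₁
  · linear_combination g₂
  · linear_combination g₃
  · linear_combination g₄
  · linear_combination g₅

/-- An affine diagonal substitution compatible with the relations is an automorphism. -/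
theorem exists_automorphism (s t : Fin 3 → K) (hs : ∀ i, s i ≠ 0)
    (h₁ : AffineCompatible D.q₁ D.a D.b D.b₁ (s 0) (t 0) (s 1) (t 1))
    (h₂ : AffineCompatible D.q₂ D.α D.γ D.b₂ (s 0) (t 0) (s 2) (t 2))
    (h₃ : AffineCompatible D.q₃ D.μ D.ν D.b₃ (s 1) (t 1) (s 2) (t 2)) :
    ∃ σ : D.Alg ≃ₐ[K] D.Alg, ∀ i, σ (D.gen i) = s i • D.gen i + algebraMap K D.Alg (t i) := by
  have key : ∀ s t : Fin 3 → K,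
      AffineCompatible D.q₁ D.a D.b D.b₁ (s 0) (t 0) (s 1) (t 1) →
      AffineCompatible D.q₂ D.α D.γ D.b₂ (s 0) (t 0) (s 2) (t 2) →
      AffineCompatible D.q₃ D.μ D.ν D.b₃ (s 1) (t 1) (s 2) (t 2) →
      ∃ f : D.Alg →ₐ[K] D.Alg, ∀ i, f (D.gen i) = s i • D.gen i + t i • (1 : D.Alg) := by
    intro s t h₁ h₂ h₃
    obtain ⟨f, hf₁, hf₂, hf₃⟩ := exists_lift hc hβ hlam (h₁.relation (x₂_mul_x₁ hc))
      (h₂.relation (x₃_mul_x₁ hβ)) (h₃.relation (x₃_mul_x₂ hlam))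
    refine ⟨f, fun i => ?_⟩
    fin_cases i
    exacts [hf₁, hf₂, hf₃]
  obtain ⟨f, hf⟩ := key s t h₁ h₂ h₃
  obtain ⟨g, hg⟩ := key (fun i => (s i)⁻¹) (fun i => -((s i)⁻¹ * t i))
    (h₁.inv (hs 0) (hs 1)) (h₂.inv (hs 0) (hs 2)) (h₃.inv (hs 1) (hs 2))
  refine ⟨AlgEquiv.ofAlgHom f g (algHom_ext fun i => ?_) (algHom_ext fun i => ?_), fun i => ?_⟩
  · rw [AlgHom.comp_apply, hg, map_add, map_smul, map_smul, hf, map_one, AlgHom.id_apply]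
    match_scalars
    · field_simp [hs i]
    · field_simp [hs i]
      ring
  · rw [AlgHom.comp_apply, hf, map_add, map_smul, map_smul, hg, map_one, AlgHom.id_apply]
    match_scalars
    · field_simp [hs i]
    · field_simp [hs i]
      ring
  · exact (hf i).trans (by rw [Algebra.algebraMap_eq_smul_one])

/-- Skew derivations `δ (p q) = δ p q + σ p δ q` with prescribed values on the generators, obtained
from algebra maps `p ↦ !![σ p, δ p; 0, p]` to upper triangular matrices. -/
theorem exists_skewDerivation (σ : D.Alg →ₐ[K] D.Alg) (y₁ y₂ y₃ : D.Alg)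
    (h₁ : y₂ * D.x₁ + σ D.x₂ * y₁ =
      D.q₁ • (y₁ * D.x₂ + σ D.x₁ * y₂) + D.a • y₁ + D.b • y₂)
    (h₂ : y₃ * D.x₁ + σ D.x₃ * y₁ =
      D.q₂ • (y₁ * D.x₃ + σ D.x₁ * y₃) + D.α • y₁ + D.γ • y₃)
    (h₃ : y₃ * D.x₂ + σ D.x₃ * y₂ =
      D.q₃ • (y₂ * D.x₃ + σ D.x₂ * y₃) + D.μ • y₂ + D.ν • y₃) :
    ∃ δ : D.Alg →ₗ[K] D.Alg, (∀ p q, δ (p * q) = δ p * q + σ p * δ q) ∧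
      δ D.x₁ = y₁ ∧ δ D.x₂ = y₂ ∧ δ D.x₃ = y₃ := by
  have key : ∀ {q u v w : K} {x y z z' : D.Alg},
      y * x = q • (x * y) + u • x + v • y + w • (1 : D.Alg) →
      z' * x + σ y * z = q • (z * y + σ x * z') + u • z + v • z' →
      !![σ y, z'; 0, y] * !![σ x, z; 0, x] = q • (!![σ x, z; 0, x] * !![σ y, z'; 0, y]) +
        u • !![σ x, z; 0, x] + v • !![σ y, z'; 0, y] +
        w • (1 : Matrix (Fin 2) (Fin 2) D.Alg) := by
    intro q u v w x y z z' h h'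
    have hσ := congrArg σ h
    simp only [map_add, map_mul, map_smul, map_one] at hσ
    ext i j
    fin_cases i <;> fin_cases j
    · simpa [Matrix.mul_apply] using hσ
    · simp [Matrix.mul_apply]
      linear_combination (norm := module) h'
    · simp [Matrix.mul_apply]
    · simpa [Matrix.mul_apply] using h
  obtain ⟨f, hf₁, hf₂, hf₃⟩ := exists_lift hc hβ hlam (key (x₂_mul_x₁ hc) h₁)
    (key (x₃_mul_x₁ hβ) h₂) (key (x₃_mul_x₂ hlam) h₃)
  have hf : ∀ p, f p 0 0 = σ p ∧ f p 1 0 = 0 ∧ f p 1 1 = p := by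
    intro p
    have hp : p ∈ Algebra.adjoin K (Set.range D.gen) := D.adjoin_gen ▸ Algebra.mem_top
    induction hp using Algebra.adjoin_induction with
    | mem y hy =>
      obtain ⟨i, rfl⟩ := hy
      fin_cases i
      · simp [gen, hf₁]
      · simp [gen, hf₂]
      · simp [gen, hf₃]
    | algebraMap r => simp [Matrix.algebraMap_matrix_apply]
    | add y z _ _ hy hz => simp [hy, hz]
    | mul y z _ _ hy hz => simp [Matrix.mul_apply, hy, hz]
  refine ⟨Matrix.entryLinearMap K D.Alg 0 1 ∘ₗ f.toLinearMap, fun p q => ?_, ?_, ?_, ?_⟩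
  · simp [Matrix.mul_apply, hf, add_comm]
  · simp [hf₁]
  · simp [hf₂]
  · simp [hf₃]

end Relations

end BiquadraticData

/-! ### The skew calculus of a bi-quadratic algebra -/

namespace BiquadraticData

variable {K : Type u} [Field K] (D : BiquadraticData K)

/-- The scaling factors of the automorphisms `ν_{x₁}`, `ν_{x₂}`, `ν_{x₃}` (rows) on the generators
(columns). -/
def scale : Fin 3 → Fin 3 → K :=
  ![![1, D.q₁, D.q₂], ![D.q₁⁻¹, 1, D.q₃], ![D.q₂⁻¹, D.q₃⁻¹, 1]]

/-- The translation parts of the automorphisms `ν_{x₁}`, `ν_{x₂}`, `ν_{x₃}` (rows) on the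
generators (columns). -/
def shift : Fin 3 → Fin 3 → K :=
  ![![0, D.a, D.α], ![-(D.b * D.q₁⁻¹), 0, D.μ], ![-(D.γ * D.q₂⁻¹), -(D.ν * D.q₃⁻¹), 0]]

/-- The scalars `θ i j` in `dxᵢ ∧ dxⱼ = θ i j • e {i, j}`, normalized so that `dxᵢ ∧ dxⱼ = e {i, j}`
for `i < j`. -/
def wedgeCoeff : Fin 3 → Fin 3 → K :=
  ![![0, 1, 1], ![-D.q₁, 0, 1], ![-D.q₂, -D.q₃, 0]]

variable {D}
variable (hc : D.c = 0) (hβ : D.β = 0) (hlam : D.lam = 0) (hPBW : D.HasPBWBasis)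
include hc hβ hlam hPBW

theorem exists_ν (h₁ : D.b₁ * (D.q₁ - 1) = D.a * D.b) (h₂ : D.b₂ * (D.q₂ - 1) = D.α * D.γ)
    (h₃ : D.b₃ * (D.q₃ - 1) = D.μ * D.ν) (i : Fin 3) :
    ∃ σ : D.Alg ≃ₐ[K] D.Alg, ∀ j,
      σ (D.gen j) = D.scale i j • D.gen j + algebraMap K D.Alg (D.shift i j) := by
  obtain ⟨o₁, o₂, o₃, o₄, o₅, o₆⟩ := overlap hc hβ hlam hPBW
  have n₁ := D.q₁_ne_zero
  have n₂ := D.q₂_ne_zero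
  have n₃ := D.q₃_ne_zero
  fin_cases i
  · refine exists_automorphism hc hβ hlam _ _ (fun j => ?_) ⟨?_, ?_, ?_⟩ ⟨?_, ?_, ?_⟩ ⟨?_, ?_, ?_⟩
    · fin_cases j <;> simp [scale, n₁, n₂]
    all_goals simp only [scale, shift, Fin.zero_eta, Matrix.cons_val]
    · ring
    · linear_combination h₁
    · ring
    · linear_combination h₂
    · linear_combination o₁
    · linear_combination o₂
    · linear_combination o₄
  · refine exists_automorphism hc hβ hlam _ _ (fun j => ?_) ⟨?_, ?_, ?_⟩ ⟨?_, ?_, ?_⟩ ⟨?_, ?_, ?_⟩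
    · fin_cases j <;> simp [scale, n₁, n₃]
    all_goals simp only [scale, shift, Fin.mk_one, Matrix.cons_val]
    · ring
    · field_simp
      ring
    · field_simp
      linear_combination -h₁
    · linear_combination -o₁
    · field_simp
      linear_combination -o₃
    · field_simp
      linear_combination -o₅ + D.b * o₁
    · ring
    · linear_combination h₃
  · refine exists_automorphism hc hβ hlam _ _ (fun j => ?_) ⟨?_, ?_, ?_⟩ ⟨?_, ?_, ?_⟩ ⟨?_, ?_, ?_⟩
    · fin_cases j <;> simp [scale, n₂, n₃]
    all_goals simp only [scale, shift, Fin.reduceFinMk, Matrix.cons_val]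
    · field_simp
      linear_combination o₂
    · field_simp
      linear_combination o₃
    · field_simp
      linear_combination o₆ - D.γ * o₂ - D.ν * o₃
    · ring
    · field_simp
      ring
    · field_simp
      linear_combination -h₂
    · ring
    · field_simp
      ring
    · field_simp
      linear_combination -h₃

theorem scale_shift (i j k : Fin 3) :
    D.scale j k * D.shift i k + D.shift j k = D.scale i k * D.shift j k + D.shift i k := by
  obtain ⟨o₁, o₂, o₃, -⟩ := overlap hc hβ hlam hPBW
  have n₁ := D.q₁_ne_zero
  have n₂ := D.q₂_ne_zero
  have n₃ := D.q₃_ne_zero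
  have key : ∀ i j k : Fin 3, i < j →
      D.scale j k * D.shift i k + D.shift j k = D.scale i k * D.shift j k + D.shift i k := by
    intro i j k hij
    fin_cases i <;> fin_cases j <;> first | exact absurd hij (by decide) | skip
    all_goals fin_cases k
    all_goals simp only [scale, shift, Fin.zero_eta, Fin.mk_one, Fin.reduceFinMk, Matrix.cons_val]
    · ring
    · ring
    · linear_combination -o₁
    · ring
    · field_simp
      linear_combination o₂
    · ring
    · field_simp
      linear_combination -o₃
    · ring
    · ring
  rcases lt_trichotomy i j with h | rfl | h
  · exact key i j k h
  · rfl
  · exact (key j i k h).symm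

/-- The skew calculus on the generators `x₁`, `x₂`, `x₃`. -/
theorem exists_skewCalculus (h₁ : D.b₁ * (D.q₁ - 1) = D.a * D.b)
    (h₂ : D.b₂ * (D.q₂ - 1) = D.α * D.γ) (h₃ : D.b₃ * (D.q₃ - 1) = D.μ * D.ν) :
    ∃ X : SkewCalculus K D.Alg (Fin 3), X.x = D.gen ∧ X.s = D.scale ∧ X.r = D.shift ∧
      X.θ = D.wedgeCoeff := by
  choose ν hν using exists_ν hc hβ hlam hPBW h₁ h₂ h₃
  have hpd : ∀ i, ∃ δ : D.Alg →ₗ[K] D.Alg, (∀ p q, δ (p * q) = δ p * q + ν i p * δ q) ∧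
      ∀ j, δ (D.gen j) = if i = j then 1 else 0 := by
    intro i
    have n₁ := D.q₁_ne_zero
    have n₂ := D.q₂_ne_zero
    have n₃ := D.q₃_ne_zero
    have hx₁ : (ν i).toAlgHom (D.gen 0) = _ := hν i 0
    have hx₂ : (ν i).toAlgHom (D.gen 1) = _ := hν i 1
    have hx₃ : (ν i).toAlgHom (D.gen 2) = _ := hν i 2
    simp only [gen, Matrix.cons_val, Algebra.algebraMap_eq_smul_one] at hx₁ hx₂ hx₃
    obtain ⟨δ, hδ, hδ₁, hδ₂, hδ₃⟩ := exists_skewDerivation hc hβ hlam (ν i).toAlgHom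
      (if i = 0 then 1 else 0) (if i = 1 then 1 else 0) (if i = 2 then 1 else 0)
      (by
        rw [hx₁, hx₂]
        fin_cases i <;> simp [scale, shift, smul_smul, smul_add, mul_comm D.q₁, n₁])
      (by
        rw [hx₁, hx₃]
        fin_cases i <;> simp [scale, shift, smul_smul, smul_add, mul_comm D.q₂, n₂])
      (by
        rw [hx₂, hx₃]
        fin_cases i <;> simp [scale, shift, smul_smul, smul_add, mul_comm D.q₃, n₃])
    refine ⟨δ, hδ, fun j => ?_⟩
    fin_cases j
    exacts [hδ₁, hδ₂, hδ₃]
  choose pd hpd_mul hpd_x using hpd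
  refine ⟨{
    ν := ν
    ν_comm := fun i j => ?_
    θ := D.wedgeCoeff
    θ_self := fun i => ?_
    θ_ne_zero := fun i j hij => ?_
    x := D.gen
    adjoin_x := D.adjoin_gen
    s := D.scale
    r := D.shift
    ν_x := hν
    s_mul_θ := fun i j hij => ?_
    pd := pd
    pd_mul := hpd_mul
    pd_x := hpd_x }, rfl, rfl, rfl, rfl⟩
  · have h : (ν i * ν j : D.Alg ≃ₐ[K] D.Alg).toAlgHom = (ν j * ν i).toAlgHom := by
      refine algHom_ext fun k => ?_
      change ν i (ν j (D.gen k)) = ν j (ν i (D.gen k))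
      rw [hν, hν, map_add, map_add, map_smul, map_smul, hν, hν, AlgEquiv.commutes,
        AlgEquiv.commutes]
      simp only [Algebra.algebraMap_eq_smul_one]
      have := scale_shift hc hβ hlam hPBW i j k
      match_scalars
      · ring
      · linear_combination this
    exact AlgEquiv.ext fun p => DFunLike.congr_fun h p
  · fin_cases i <;> rfl
  · fin_cases i <;> fin_cases j <;>
      simp [wedgeCoeff, D.q₁_ne_zero, D.q₂_ne_zero, D.q₃_ne_zero] at hij ⊢
  · fin_cases i <;> fin_cases j <;>
      simp [wedgeCoeff, scale, D.q₁_ne_zero, D.q₂_ne_zero, D.q₃_ne_zero] at hij ⊢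

end BiquadraticData

/-! ### Connectedness -/

/-- Let `T` send each vector `v e` of a linearly independent family to a multiple `wt e • v (sh e)`,
where `sh` is injective. If `T` kills a linear combination, then every `v e` occurring in it has
`wt e = 0`. Only indices in the support of the combination matter. -/
theorem LinearIndependent.coeff_eq_zero_of_map_eq_zero {K : Type u} {A : Type v} [Field K]
    [AddCommGroup A] [Module K A] {J : Type} {v : J → A} (hv : LinearIndependent K v)
    (T : A →ₗ[K] A) (l : J →₀ K) (wt : J → K) (sh : J → J)
    (hT : ∀ e, l e ≠ 0 → T (v e) = wt e • v (sh e))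
    (hsh : ∀ e e', wt e ≠ 0 → wt e' ≠ 0 → sh e = sh e' → e = e')
    (h : T (Finsupp.linearCombination K v l) = 0) (e : J) (he : wt e ≠ 0) : l e = 0 := by
  by_contra hle
  have h₁ : ∑ e ∈ l.support, (l e * wt e) • v (sh e) = 0 := by
    rw [Finsupp.linearCombination_apply, Finsupp.sum, map_sum] at h
    rw [← h]
    refine Finset.sum_congr rfl fun e he => ?_
    rw [map_smul, hT e (Finsupp.mem_support_iff.1 he), mul_smul]
  classical
  have h₂ : ∑ e ∈ l.support with wt e ≠ 0, (l e * wt e) • v (sh e) = 0 := by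
    rw [← h₁]
    refine Finset.sum_subset (Finset.filter_subset _ _) fun e he he' => ?_
    have : wt e = 0 := by simpa [Finsupp.mem_support_iff.1 he] using he'
    rw [this, mul_zero, zero_smul]
  have hli : LinearIndependent K fun e : {e // wt e ≠ 0} => v (sh e) :=
    hv.comp (fun e : {e // wt e ≠ 0} => sh e) fun e e' hee' =>
      Subtype.ext (hsh e e' e.2 e'.2 hee')
  have h₃ := linearIndependent_iff'.1 hli (l.support.subtype fun e => wt e ≠ 0)
    (fun e => l e * wt e) (by
      rw [← h₂]
      exact Finset.sum_subtype_eq_sum_filter (fun e => (l e * wt e) • v (sh e)))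
    ⟨e, he⟩ (by simpa using hle)
  exact mul_ne_zero hle he h₃

namespace SkewCalculus

variable {K : Type u} {A : Type v} {I : Type} [Field K] [Ring A] [Algebra K A] [DecidableEq I]
variable (X : SkewCalculus K A I)

theorem pd_pow_of_ne {i j : I} (h : i ≠ j) (n : ℕ) : X.pd i (X.x j ^ n) = 0 := by
  induction n with
  | zero => rw [pow_zero, X.pd_one]
  | succ n ih => rw [pow_succ, X.pd_mul, ih, X.pd_x, if_neg h, zero_mul, mul_zero, add_zero]

theorem pd_pow_self {i : I} (h : X.ν i (X.x i) = X.x i) (n : ℕ) :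
    X.pd i (X.x i ^ n) = (n : K) • X.x i ^ (n - 1) := by
  induction n with
  | zero => rw [pow_zero, X.pd_one, Nat.cast_zero, zero_smul]
  | succ n ih =>
    rw [pow_succ, X.pd_mul, ih, X.pd_x, if_pos rfl, map_pow, h, mul_one, smul_mul_assoc]
    rcases n with - | n
    · simp
    · rw [Nat.add_sub_cancel, Nat.add_sub_cancel, ← pow_succ]
      push_cast
      module

end SkewCalculus

namespace BiquadraticData

variable {K : Type u} [Field K] {D : BiquadraticData K}

theorem eq_algebraMap_of_pd_eq_zero [CharZero K] (hPBW : D.HasPBWBasis)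
    (X : SkewCalculus K D.Alg (Fin 3)) (hx : X.x = D.gen)
    (hν : ∀ i, X.ν i (D.gen i) = D.gen i) {p : D.Alg} (hp : ∀ i, X.pd i p = 0) :
    ∃ r : K, p = algebraMap K D.Alg r := by
  have hself : ∀ (i : Fin 3) (n : ℕ), X.pd i (D.gen i ^ n) = (n : K) • D.gen i ^ (n - 1) := by
    rw [← hx] at hν ⊢
    exact fun i => X.pd_pow_self (hν i)
  have hne : ∀ (i j : Fin 3) (n : ℕ), i ≠ j → X.pd i (D.gen j ^ n) = 0 := by
    rw [← hx]
    exact fun i j n h => X.pd_pow_of_ne h n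
  have hmon : ∀ e, D.monomial e = D.gen 0 ^ e.1 * D.gen 1 ^ e.2.1 * D.gen 2 ^ e.2.2 :=
    fun _ => rfl
  obtain ⟨l, rfl⟩ := Finsupp.mem_span_range_iff_exists_finsupp.1
    (hPBW.2 ▸ Submodule.mem_top : p ∈ Submodule.span K (Set.range D.monomial))
  change ∀ i, X.pd i (Finsupp.linearCombination K D.monomial l) = 0 at hp
  -- The derivations remove in turn the monomials which involve `x₁`, `x₂` and `x₃`.
  have h₀ : ∀ e, l e ≠ 0 → e.1 = 0 := by
    intro e hle
    by_contra he
    refine hle (hPBW.1.coeff_eq_zero_of_map_eq_zero (X.pd 0) l (fun e => (e.1 : K))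
      (fun e => (e.1 - 1, e.2)) (fun e _ => ?_) (fun e e' he he' h => ?_) (hp 0) e
      (Nat.cast_ne_zero.2 he))
    · simp only [hmon, mul_assoc]
      rw [X.pd_mul, X.pd_mul, hself, hne 0 1 _ (by decide), hne 0 2 _ (by decide)]
      simp only [zero_mul, mul_zero, add_zero, smul_mul_assoc]
    · rw [Nat.cast_ne_zero] at he he'
      simp only [Prod.mk.injEq] at h
      exact Prod.ext (by omega) h.2
  have h₁ : ∀ e, l e ≠ 0 → e.2.1 = 0 := by
    intro e hle
    by_contra he
    refine hle (hPBW.1.coeff_eq_zero_of_map_eq_zero (X.pd 1) l (fun e => (e.2.1 : K))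
      (fun e => (e.1, e.2.1 - 1, e.2.2)) (fun e hle => ?_) (fun e e' he he' h => ?_) (hp 1) e
      (Nat.cast_ne_zero.2 he))
    · simp only [hmon, h₀ e hle, pow_zero, one_mul]
      rw [X.pd_mul, hself, hne 1 2 _ (by decide)]
      simp only [mul_zero, add_zero, smul_mul_assoc]
    · rw [Nat.cast_ne_zero] at he he'
      simp only [Prod.mk.injEq] at h
      exact Prod.ext h.1 (Prod.ext (by omega) h.2.2)
  have h₂ : ∀ e, l e ≠ 0 → e.2.2 = 0 := by
    intro e hle
    by_contra he
    refine hle (hPBW.1.coeff_eq_zero_of_map_eq_zero (X.pd 2) l (fun e => (e.2.2 : K))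
      (fun e => (e.1, e.2.1, e.2.2 - 1)) (fun e hle => ?_) (fun e e' he he' h => ?_) (hp 2) e
      (Nat.cast_ne_zero.2 he))
    · simp only [hmon, h₀ e hle, h₁ e hle, pow_zero, one_mul]
      rw [hself]
    · rw [Nat.cast_ne_zero] at he he'
      simp only [Prod.mk.injEq] at h
      exact Prod.ext h.1 (Prod.ext h.2.1 (by omega))
  refine ⟨l (0, 0, 0), ?_⟩
  rw [Finsupp.sum, Finset.sum_eq_single (0, 0, 0)]
  · simp [monomial, Algebra.algebraMap_eq_smul_one]
  · intro e he hne
    have hle := Finsupp.mem_support_iff.1 he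
    exact absurd (Prod.ext (h₀ e hle) (Prod.ext (h₁ e hle) (h₂ e hle))) hne
  · intro h
    rw [Finsupp.notMem_support_iff.1 h, zero_smul]

end BiquadraticData

/-! ### Gelfand–Kirillov dimension -/

section GKdim

variable {K : Type u} {A : Type v} [Field K] [Ring A] [Algebra K A]

open Filter Topology

theorem tendsto_const_add_div_log (d c : ℝ) :
    Tendsto (fun n : ℕ => ((d + c / Real.log n : ℝ) : EReal)) atTop (𝓝 (d : EReal)) := by
  refine (continuous_coe_real_ereal.tendsto d).comp ?_
  have h : Tendsto (fun n : ℕ => c / Real.log n) atTop (𝓝 0) :=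
    tendsto_const_nhds.div_atTop (Real.tendsto_log_atTop.comp tendsto_natCast_atTop_atTop)
  simpa using tendsto_const_nhds.add h

/-- Growth of degree at most `d` bounds the Gelfand–Kirillov dimension by `d`. -/
theorem GKdim_le {d : ℕ} (h : ∀ V : Submodule K A, FiniteDimensional K V →
    ∃ m : ℕ, ∀ n : ℕ, Module.finrank K ↥((1 ⊔ V) ^ n) ≤ (m * n + 1) ^ d) : GKdim K A ≤ d := by
  refine iSup_le fun V => ?_
  obtain ⟨m, hm⟩ := h V.1 V.2
  have ht := tendsto_const_add_div_log d (d * Real.log (m + 1))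
  refine (limsup_le_limsup (v := fun n : ℕ =>
    ((d + d * Real.log (m + 1) / Real.log n : ℝ) : EReal)) ?_).trans ht.limsup_eq.le
  filter_upwards [eventually_ge_atTop 2] with n hn
  rw [EReal.coe_le_coe_iff]
  have hn' : (2 : ℝ) ≤ n := by exact_mod_cast hn
  have hlog : 0 < Real.log n := Real.log_pos (by linarith)
  have h₁ : (Module.finrank K ↥((1 ⊔ V.1) ^ n) : ℝ) ≤ ((m + 1) * n : ℝ) ^ d := by
    refine le_trans (by exact_mod_cast hm n : _ ≤ (((m * n + 1 : ℕ) : ℝ)) ^ d) ?_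
    refine pow_le_pow_left₀ (by positivity) ?_ d
    push_cast
    linarith
  have h₂ : Real.log (Module.finrank K ↥((1 ⊔ V.1) ^ n)) ≤ Real.log (((m + 1) * n : ℝ) ^ d) := by
    rcases (Nat.cast_nonneg (α := ℝ) (Module.finrank K ↥((1 ⊔ V.1) ^ n))).eq_or_lt with h₀ | h₀
    · rw [← h₀, Real.log_zero, Real.log_pow]
      exact mul_nonneg (Nat.cast_nonneg d) (Real.log_nonneg (by nlinarith))
    · exact Real.log_le_log h₀ h₁
  rw [Real.log_pow, Real.log_mul (by positivity) (by positivity)] at h₂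
  rw [div_le_iff₀ hlog, add_mul, div_mul_cancel₀ _ hlog.ne']
  linarith

/-- Growth of degree at least `d` bounds the Gelfand–Kirillov dimension below by `d`. -/
theorem le_GKdim {d : ℕ} (V : Submodule K A) [hV : FiniteDimensional K V] {c : ℕ} (hc : 0 < c)
    (h : ∀ n : ℕ, (n / c + 1) ^ d ≤ Module.finrank K ↥((1 ⊔ V) ^ n)) : d ≤ GKdim K A := by
  refine le_iSup_of_le ⟨V, hV⟩ ?_
  have ht := tendsto_const_add_div_log d (-(d * Real.log c))
  refine ht.limsup_eq.ge.trans (limsup_le_limsup ?_)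
  filter_upwards [eventually_ge_atTop 2] with n hn
  rw [EReal.coe_le_coe_iff]
  have hn' : (2 : ℝ) ≤ n := by exact_mod_cast hn
  have hlog : 0 < Real.log n := Real.log_pos (by linarith)
  have hc' : (0 : ℝ) < c := by exact_mod_cast hc
  have h₁ : ((n : ℝ) / c) ^ d ≤ Module.finrank K ↥((1 ⊔ V) ^ n) := by
    refine le_trans ?_ (by exact_mod_cast h n : (((n / c + 1 : ℕ) : ℝ)) ^ d ≤ _)
    refine pow_le_pow_left₀ (by positivity) ?_ d
    rw [div_le_iff₀ hc']
    exact_mod_cast (Nat.lt_div_mul_add hc).le.trans (by rw [add_mul, one_mul])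
  have h₂ := Real.log_le_log (by positivity) h₁
  rw [Real.log_pow, Real.log_div (by positivity) hc'.ne'] at h₂
  rw [le_div_iff₀ hlog, add_mul, div_mul_cancel₀ _ hlog.ne']
  linarith

end GKdim

namespace BiquadraticData

variable {K : Type u} [Field K] {D : BiquadraticData K}

/-- The exponents of total degree at most `N`. -/
def exponents (N : ℕ) : Finset (ℕ × ℕ × ℕ) :=
  (Finset.range (N + 1) ×ˢ Finset.range (N + 1) ×ˢ Finset.range (N + 1)).filter
    fun e => e.1 + e.2.1 + e.2.2 ≤ N

theorem mem_exponents {N : ℕ} {e : ℕ × ℕ × ℕ} :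
    e ∈ exponents N ↔ e.1 + e.2.1 + e.2.2 ≤ N := by
  simp only [exponents, Finset.mem_filter, Finset.mem_product, Finset.mem_range]
  omega

theorem card_exponents_le (N : ℕ) : (exponents N).card ≤ (N + 1) ^ 3 := by
  refine (Finset.card_filter_le _ _).trans ?_
  rw [Finset.card_product, Finset.card_product, Finset.card_range]
  exact (by ring : (N + 1) * ((N + 1) * (N + 1)) = (N + 1) ^ 3).le

variable (D) in
/-- The span of the monomials of total degree at most `N`. -/
noncomputable def filtration (N : ℕ) : Submodule K D.Alg :=
  Submodule.span K (D.monomial '' (exponents N : Set (ℕ × ℕ × ℕ)))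

theorem monomial_mem_filtration {N : ℕ} {e : ℕ × ℕ × ℕ} (h : e.1 + e.2.1 + e.2.2 ≤ N) :
    D.monomial e ∈ D.filtration N :=
  Submodule.subset_span ⟨e, mem_exponents.2 h, rfl⟩

theorem filtration_le {N : ℕ} {P : Submodule K D.Alg}
    (h : ∀ i j k : ℕ, i + j + k ≤ N → D.x₁ ^ i * D.x₂ ^ j * D.x₃ ^ k ∈ P) :
    D.filtration N ≤ P := by
  rw [filtration, Submodule.span_le]
  rintro _ ⟨e, he, rfl⟩
  exact h _ _ _ (mem_exponents.1 he)

theorem filtration_mono {M N : ℕ} (h : M ≤ N) : D.filtration M ≤ D.filtration N :=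
  filtration_le fun i j k hijk => monomial_mem_filtration (e := (i, j, k)) (hijk.trans h)

instance (N : ℕ) : FiniteDimensional K (D.filtration N) :=
  FiniteDimensional.span_of_finite K ((exponents N).finite_toSet.image _)

theorem finrank_filtration_le (N : ℕ) : Module.finrank K (D.filtration N) ≤ (N + 1) ^ 3 := by
  classical
  have h := finrank_span_finset_le_card (R := K) ((exponents N).image D.monomial)
  rw [Set.finrank, Finset.coe_image] at h
  exact h.trans (Finset.card_image_le.trans (card_exponents_le N))

theorem x₁_mul_mem {N : ℕ} {p : D.Alg} (hp : p ∈ D.filtration N) :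
    D.x₁ * p ∈ D.filtration (N + 1) := by
  refine filtration_le (P := (D.filtration (N + 1)).comap (LinearMap.mulLeft K D.x₁))
    (fun i j k h => ?_) hp
  have h' := monomial_mem_filtration (D := D) (N := N + 1) (e := (i + 1, j, k))
    (by dsimp only; omega)
  rw [monomial, pow_succ'] at h'
  simpa [mul_assoc] using h'

variable (hc : D.c = 0) (hβ : D.β = 0) (hlam : D.lam = 0)

include hc in
theorem x₂_mul_mem {N : ℕ} {p : D.Alg} (hp : p ∈ D.filtration N) :
    D.x₂ * p ∈ D.filtration (N + 1) := by
  induction N generalizing p with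
  | zero =>
    refine filtration_le (P := (D.filtration 1).comap (LinearMap.mulLeft K D.x₂))
      (fun i j k h => ?_) hp
    obtain ⟨rfl, rfl, rfl⟩ : i = 0 ∧ j = 0 ∧ k = 0 := by omega
    simpa [monomial] using monomial_mem_filtration (D := D) (N := 1) (e := (0, 1, 0)) (by simp)
  | succ N ih =>
    refine filtration_le (P := (D.filtration (N + 2)).comap (LinearMap.mulLeft K D.x₂))
      (fun i j k h => ?_) hp
    rw [Submodule.mem_comap, LinearMap.mulLeft_apply]
    rcases i with - | i
    · have h' := monomial_mem_filtration (D := D) (N := N + 2) (e := (0, j + 1, k))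
        (by dsimp only; omega)
      rw [monomial, pow_succ'] at h'
      simpa [mul_assoc] using h'
    · have hm := monomial_mem_filtration (D := D) (N := N) (e := (i, j, k))
        (by dsimp only; omega)
      have h' : D.x₂ * (D.x₁ ^ (i + 1) * D.x₂ ^ j * D.x₃ ^ k) =
          D.q₁ • (D.x₁ * (D.x₂ * D.monomial (i, j, k))) + D.a • (D.x₁ * D.monomial (i, j, k)) +
            D.b • (D.x₂ * D.monomial (i, j, k)) + D.b₁ • D.monomial (i, j, k) := by
        rw [pow_succ', mul_assoc, mul_assoc, ← mul_assoc, x₂_mul_x₁ hc]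
        simp only [monomial, add_mul, smul_mul_assoc, mul_assoc, one_mul]
      rw [h']
      refine add_mem (add_mem (add_mem ?_ ?_) ?_) ?_ <;> refine Submodule.smul_mem _ _ ?_
      · exact x₁_mul_mem (ih hm)
      · exact filtration_mono (by omega) (x₁_mul_mem hm)
      · exact filtration_mono (by omega) (ih hm)
      · exact filtration_mono (by omega) hm

include hc hβ hlam

theorem x₃_mul_mem {N : ℕ} {p : D.Alg} (hp : p ∈ D.filtration N) :
    D.x₃ * p ∈ D.filtration (N + 1) := by
  induction N generalizing p with
  | zero =>
    refine filtration_le (P := (D.filtration 1).comap (LinearMap.mulLeft K D.x₃))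
      (fun i j k h => ?_) hp
    obtain ⟨rfl, rfl, rfl⟩ : i = 0 ∧ j = 0 ∧ k = 0 := by omega
    simpa [monomial] using monomial_mem_filtration (D := D) (N := 1) (e := (0, 0, 1)) (by simp)
  | succ N ih =>
    refine filtration_le (P := (D.filtration (N + 2)).comap (LinearMap.mulLeft K D.x₃))
      (fun i j k h => ?_) hp
    rw [Submodule.mem_comap, LinearMap.mulLeft_apply]
    rcases i with - | i
    · rcases j with - | j
      · have h' := monomial_mem_filtration (D := D) (N := N + 2) (e := (0, 0, k + 1))
          (by dsimp only; omega)
        rw [monomial, pow_succ'] at h'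
        simpa [mul_assoc] using h'
      · have hm := monomial_mem_filtration (D := D) (N := N) (e := (0, j, k))
          (by dsimp only; omega)
        have h' : D.x₃ * (D.x₁ ^ 0 * D.x₂ ^ (j + 1) * D.x₃ ^ k) =
            D.q₃ • (D.x₂ * (D.x₃ * D.monomial (0, j, k))) +
              D.μ • (D.x₂ * D.monomial (0, j, k)) +
              D.ν • (D.x₃ * D.monomial (0, j, k)) + D.b₃ • D.monomial (0, j, k) := by
          rw [pow_succ', pow_zero, one_mul, mul_assoc, ← mul_assoc, x₃_mul_x₂ hlam]
          simp only [monomial, pow_zero, add_mul, smul_mul_assoc, mul_assoc, one_mul]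
        rw [h']
        refine add_mem (add_mem (add_mem ?_ ?_) ?_) ?_ <;> refine Submodule.smul_mem _ _ ?_
        · exact x₂_mul_mem hc (ih hm)
        · exact filtration_mono (by omega) (x₂_mul_mem hc hm)
        · exact filtration_mono (by omega) (ih hm)
        · exact filtration_mono (by omega) hm
    · have hm := monomial_mem_filtration (D := D) (N := N) (e := (i, j, k))
        (by dsimp only; omega)
      have h' : D.x₃ * (D.x₁ ^ (i + 1) * D.x₂ ^ j * D.x₃ ^ k) =
          D.q₂ • (D.x₁ * (D.x₃ * D.monomial (i, j, k))) + D.α • (D.x₁ * D.monomial (i, j, k)) +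
            D.γ • (D.x₃ * D.monomial (i, j, k)) + D.b₂ • D.monomial (i, j, k) := by
        rw [pow_succ', mul_assoc, mul_assoc, ← mul_assoc, x₃_mul_x₁ hβ]
        simp only [monomial, add_mul, smul_mul_assoc, mul_assoc, one_mul]
      rw [h']
      refine add_mem (add_mem (add_mem ?_ ?_) ?_) ?_ <;> refine Submodule.smul_mem _ _ ?_
      · exact x₁_mul_mem (ih hm)
      · exact filtration_mono (by omega) (x₁_mul_mem hm)
      · exact filtration_mono (by omega) (ih hm)
      · exact filtration_mono (by omega) hm

theorem filtration_mul_le (M N : ℕ) :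
    D.filtration M * D.filtration N ≤ D.filtration (N + M) := by
  have hpow : ∀ y : D.Alg, (∀ {N p}, p ∈ D.filtration N → y * p ∈ D.filtration (N + 1)) →
      ∀ n {N p}, p ∈ D.filtration N → y ^ n * p ∈ D.filtration (N + n) := by
    intro y hy n
    induction n with
    | zero => simp
    | succ n ih =>
      intro N p hp
      rw [pow_succ', mul_assoc]
      exact hy (ih hp)
  rw [Submodule.mul_le]
  intro p hp q hq
  refine filtration_le (P := (D.filtration (N + M)).comap (LinearMap.mulRight K q))
    (fun i j k h => ?_) hp
  rw [Submodule.mem_comap, LinearMap.mulRight_apply, mul_assoc, mul_assoc]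
  have h' := hpow D.x₁ x₁_mul_mem i (hpow D.x₂ (x₂_mul_mem hc) j
    (hpow D.x₃ (x₃_mul_mem hc hβ hlam) k hq))
  exact filtration_mono (by omega) h'

theorem GKdim_eq_three (hPBW : D.HasPBWBasis) : GKdim K D.Alg = (3 : ℕ) := by
  apply le_antisymm
  · refine GKdim_le fun V hV => ?_
    have hex : ∀ p : D.Alg, ∃ m, p ∈ D.filtration m := by
      intro p
      have hp : p ∈ Submodule.span K (Set.range D.monomial) := hPBW.2 ▸ Submodule.mem_top
      induction hp using Submodule.span_induction with
      | mem p hp =>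
        obtain ⟨e, rfl⟩ := hp
        exact ⟨_, monomial_mem_filtration le_rfl⟩
      | zero => exact ⟨0, zero_mem _⟩
      | add p q _ _ hp hq =>
        obtain ⟨m, hm⟩ := hp
        obtain ⟨n, hn⟩ := hq
        exact ⟨max m n, add_mem (filtration_mono (le_max_left _ _) hm)
          (filtration_mono (le_max_right _ _) hn)⟩
      | smul r p _ hp =>
        obtain ⟨m, hm⟩ := hp
        exact ⟨m, Submodule.smul_mem _ _ hm⟩
    obtain ⟨S, hS⟩ := (Submodule.fg_iff_finiteDimensional V).2 hV
    choose deg hdeg using hex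
    have hV' : 1 ⊔ V ≤ D.filtration (S.sup deg) := by
      refine sup_le ?_ ?_
      · rw [Submodule.one_le]
        simpa [monomial] using
          monomial_mem_filtration (D := D) (N := S.sup deg) (e := (0, 0, 0)) (by simp)
      · rw [← hS, Submodule.span_le]
        exact fun p hp => filtration_mono (Finset.le_sup (f := deg) hp) (hdeg p)
    refine ⟨S.sup deg, fun n => ?_⟩
    have hle : (1 ⊔ V) ^ n ≤ D.filtration (S.sup deg * n) := by
      induction n with
      | zero =>
        rw [pow_zero, Submodule.one_le]
        simpa [monomial] using
          monomial_mem_filtration (D := D) (N := S.sup deg * 0) (e := (0, 0, 0)) (by simp)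
      | succ n ih =>
        rw [pow_succ']
        exact (mul_le_mul' hV' ih).trans (filtration_mul_le hc hβ hlam _ _)
    exact (Submodule.finrank_mono hle).trans (finrank_filtration_le _)
  · have hfd : FiniteDimensional K (Submodule.span K (Set.range D.gen)) :=
      FiniteDimensional.span_of_finite K (Set.finite_range _)
    refine le_GKdim (Submodule.span K (Set.range D.gen)) (c := 3) (by norm_num) fun n => ?_
    set W := 1 ⊔ Submodule.span K (Set.range D.gen) with hW
    have hfd' : FiniteDimensional K ↥(W ^ n) := by
      have hfg : W.FG := Submodule.FG.sup (by
        rw [Submodule.one_eq_span]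
        exact Submodule.fg_span_singleton 1) ((Submodule.fg_iff_finiteDimensional _).2 hfd)
      exact (Submodule.fg_iff_finiteDimensional _).1 (hfg.pow n)
    have hgen : ∀ i, D.gen i ∈ W := fun i =>
      Submodule.mem_sup_right (Submodule.subset_span ⟨i, rfl⟩)
    -- All exponents up to `n / 3` are allowed, so that the total degree is at most `n`.
    let v : Fin (n / 3 + 1) × Fin (n / 3 + 1) × Fin (n / 3 + 1) → ↥(W ^ n) := fun e =>
      ⟨D.monomial (e.1, e.2.1, e.2.2), by
        have h : D.monomial (e.1, e.2.1, e.2.2) ∈ W ^ ((e.1 : ℕ) + e.2.1 + e.2.2) := by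
          rw [pow_add, pow_add]
          exact Submodule.mul_mem_mul (Submodule.mul_mem_mul (Submodule.pow_mem_pow _ (hgen 0) _)
            (Submodule.pow_mem_pow _ (hgen 1) _)) (Submodule.pow_mem_pow _ (hgen 2) _)
        exact (pow_le_pow_right' (a := W) le_sup_left (by omega) : _ ≤ W ^ n) h⟩
    have hv : LinearIndependent K v := by
      refine LinearIndependent.of_comp (W ^ n).subtype ?_
      refine hPBW.1.comp (fun e : Fin (n / 3 + 1) × Fin (n / 3 + 1) × Fin (n / 3 + 1) =>
        ((e.1 : ℕ), (e.2.1 : ℕ), (e.2.2 : ℕ))) fun e e' h => ?_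
      simp only [Prod.mk.injEq] at h
      exact Prod.ext (Fin.ext h.1) (Prod.ext (Fin.ext h.2.1) (Fin.ext h.2.2))
    have hcard := hv.fintype_card_le_finrank
    simp only [Fintype.card_prod, Fintype.card_fin] at hcard
    exact (by ring : (n / 3 + 1) ^ 3 = (n / 3 + 1) * ((n / 3 + 1) * (n / 3 + 1))).le.trans hcard

end BiquadraticData

/-! ### Differential smoothness -/

theorem theorem3p1 {K : Type u} [Field K] [CharZero K] (D : BiquadraticData K)
    (hPBW : D.HasPBWBasis)
    (hc : D.c = 0) (hβ : D.β = 0) (hlam : D.lam = 0)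
    (h₁ : D.b₁ * (D.q₁ - 1) = D.a * D.b)
    (h₂ : D.b₂ * (D.q₂ - 1) = D.α * D.γ)
    (h₃ : D.b₃ * (D.q₃ - 1) = D.μ * D.ν)
    (hμa : D.μ * D.a = 0) :
    IsDifferentiallySmooth K D.Alg ∧ GKdim K D.Alg = 3 ∧
    ∃ ν₁ ν₂ ν₃ : D.Alg ≃ₐ[K] D.Alg,
      -- the three automorphisms on the generators
      (ν₁ D.x₁ = D.x₁ ∧ ν₁ D.x₂ = D.q₁ • D.x₂ + algebraMap K _ D.a ∧
        ν₁ D.x₃ = D.q₂ • D.x₃ + algebraMap K _ D.α) ∧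
      (ν₂ D.x₁ = D.q₁⁻¹ • D.x₁ - algebraMap K _ (D.b * D.q₁⁻¹) ∧ ν₂ D.x₂ = D.x₂ ∧
        ν₂ D.x₃ = D.q₃ • D.x₃ + algebraMap K _ D.μ) ∧
      (ν₃ D.x₁ = D.q₂⁻¹ • D.x₁ - algebraMap K _ (D.γ * D.q₂⁻¹) ∧
        ν₃ D.x₂ = D.q₃⁻¹ • D.x₂ - algebraMap K _ (D.ν * D.q₃⁻¹) ∧ ν₃ D.x₃ = D.x₃) ∧
      -- they commute
      (∀ p, ν₁ (ν₂ p) = ν₂ (ν₁ p)) ∧ (∀ p, ν₁ (ν₃ p) = ν₃ (ν₁ p)) ∧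
      (∀ p, ν₂ (ν₃ p) = ν₃ (ν₂ p)) ∧
      ∃ Ω : DifferentialCalculus K D.Alg,
        Ω.HasDimension 3 ∧ Ω.IsConnected ∧ Ω.IsIntegrable 3 ∧
        -- the bimodule of one-forms
        Ω.IsRightBasis 1 ![Ω.dOf D.x₁, Ω.dOf D.x₂, Ω.dOf D.x₃] ∧
        (∀ p, Ω.ι p * Ω.dOf D.x₁ = Ω.dOf D.x₁ * Ω.ι (ν₁ p)) ∧
        (∀ p, Ω.ι p * Ω.dOf D.x₂ = Ω.dOf D.x₂ * Ω.ι (ν₂ p)) ∧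
        (∀ p, Ω.ι p * Ω.dOf D.x₃ = Ω.dOf D.x₃ * Ω.ι (ν₃ p)) ∧
        -- two-forms
        Ω.dOf D.x₂ * Ω.dOf D.x₁ = -(D.q₁ • (Ω.dOf D.x₁ * Ω.dOf D.x₂)) ∧
        Ω.dOf D.x₃ * Ω.dOf D.x₁ = -(D.q₂ • (Ω.dOf D.x₁ * Ω.dOf D.x₃)) ∧
        Ω.dOf D.x₃ * Ω.dOf D.x₂ = -(D.q₃ • (Ω.dOf D.x₂ * Ω.dOf D.x₃)) ∧
        Ω.IsRightBasis 2 ![Ω.dOf D.x₁ * Ω.dOf D.x₂, Ω.dOf D.x₁ * Ω.dOf D.x₃,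
          Ω.dOf D.x₂ * Ω.dOf D.x₃] ∧
        -- the volume form
        Ω.IsVolumeForm 3 (Ω.dOf D.x₁ * Ω.dOf D.x₂ * Ω.dOf D.x₃) ∧
        Ω.IsIntegratingForm 3 (Ω.dOf D.x₁ * Ω.dOf D.x₂ * Ω.dOf D.x₃) := by
  obtain ⟨X, hx, hs, hr, hθ⟩ := BiquadraticData.exists_skewCalculus hc hβ hlam hPBW h₁ h₂ h₃
  have : Nontrivial D.Alg := ⟨⟨_, _, hPBW.1.ne_zero (0, 0, 0)⟩⟩
  have hx₁ : D.x₁ = X.x 0 := (congrFun hx 0).symm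
  have hx₂ : D.x₂ = X.x 1 := (congrFun hx 1).symm
  have hx₃ : D.x₃ = X.x 2 := (congrFun hx 2).symm
  have hν : ∀ i j, X.ν i (X.x j) =
      D.scale i j • X.x j + algebraMap K D.Alg (D.shift i j) := by
    intro i j
    rw [X.ν_x, hs, hr]
  have hGK := BiquadraticData.GKdim_eq_three hc hβ hlam hPBW
  have hdim : X.calculus.HasDimension 3 := X.hasDimension
  have hconn : X.calculus.IsConnected := by
    intro p
    rw [X.dOf_eq_zero_iff]
    constructor
    · refine fun hp => BiquadraticData.eq_algebraMap_of_pd_eq_zero hPBW X hx (fun i => ?_) hp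
      rw [← hx, hν]
      fin_cases i <;> simp [BiquadraticData.scale, BiquadraticData.shift]
    · rintro ⟨r, rfl⟩ i
      exact X.pd_algebraMap i r
  have hint := X.isIntegratingForm (N := 1) odd_one rfl
  have hintegrable : X.calculus.IsIntegrable 3 := ⟨hint.choose⟩
  have h₁₂ : X.calculus.dOf (X.x 0) * X.calculus.dOf (X.x 1) = (SkewFrame.Form.single {0, 1} 1 : X.Form) := by
    rw [X.dOf_x_mul_dOf_x, hθ]
    exact one_smul K _
  have h₁₃ : X.calculus.dOf (X.x 0) * X.calculus.dOf (X.x 2) = (SkewFrame.Form.single {0, 2} 1 : X.Form) := by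
    rw [X.dOf_x_mul_dOf_x, hθ]
    exact one_smul K _
  have h₂₃ : X.calculus.dOf (X.x 1) * X.calculus.dOf (X.x 2) = (SkewFrame.Form.single {1, 2} 1 : X.Form) := by
    rw [X.dOf_x_mul_dOf_x, hθ]
    exact one_smul K _
  have h₁₂₃ : X.calculus.dOf (X.x 0) * X.calculus.dOf (X.x 1) * X.calculus.dOf (X.x 2) =
      (SkewFrame.Form.single Finset.univ 1 : X.Form) := by
    rw [h₁₂, X.dOf_x]
    refine (SkewFrame.Form.single_mul_single {0, 1} {2} 1 1).trans ?_
    have hu : ({0, 1} ∪ {2} : Finset (Fin 3)) = Finset.univ := by decide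
    have hcoeff : X.coeff {0, 1} {2} = 1 := by
      simp [SkewFrame.coeff, hθ, BiquadraticData.wedgeCoeff]
    rw [hu, hcoeff, one_smul, map_one, one_mul]
  refine ⟨⟨inferInstance, 3, hGK, X.calculus, hdim, hconn, hintegrable⟩, hGK, X.ν 0, X.ν 1, X.ν 2,
    ?_, ?_, ?_, ?_, ?_, ?_, X.calculus, hdim, hconn, hintegrable, ?_⟩
  · simp [hx₁, hx₂, hx₃, hν, BiquadraticData.scale, BiquadraticData.shift]
  · simp [hx₁, hx₂, hx₃, hν, BiquadraticData.scale, BiquadraticData.shift, sub_eq_add_neg]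
  · simp [hx₁, hx₂, hx₃, hν, BiquadraticData.scale, BiquadraticData.shift, sub_eq_add_neg]
  · exact DFunLike.congr_fun (X.ν_comm 0 1)
  · exact DFunLike.congr_fun (X.ν_comm 0 2)
  · exact DFunLike.congr_fun (X.ν_comm 1 2)
  · rw [hx₁, hx₂, hx₃, h₁₂₃, h₁₂, h₁₃, h₂₃]
    refine ⟨X.isRightBasis ![{0}, {1}, {2}] _ (fun j => ?_) (by decide) (by decide),
      X.ι_mul_dOf_x 0, X.ι_mul_dOf_x 1, X.ι_mul_dOf_x 2, ?_, ?_, ?_,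
      X.isRightBasis ![{0, 1}, {0, 2}, {1, 2}] _ (fun j => ?_) (by decide) (by decide),
      X.isVolumeForm, hint⟩
    · fin_cases j
      exacts [X.dOf_x 0, X.dOf_x 1, X.dOf_x 2]
    · rw [X.dOf_x_mul_dOf_x, hθ, Finset.pair_comm]
      exact neg_smul D.q₁ _
    · rw [X.dOf_x_mul_dOf_x, hθ, Finset.pair_comm]
      exact neg_smul D.q₂ _
    · rw [X.dOf_x_mul_dOf_x, hθ, Finset.pair_comm]
      exact neg_smul D.q₃ _
    · fin_cases j <;> rfl
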